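/- **Setting.** Let $n,m\ge 1$, let $\mathcal G$ be a connected undirected graph on $\{1,\dots,m\}$, and let $\mathbf W\in\mathbb R^{m\times m}$ be symmetric, doubly stochastic and strictly diagonally dominant ($\mathbf W_{ii}>\sum_{j\ne i}\mathbf W_{ij}$), with $\mathbf W_{ii}>0$, $\mathbf W_{ij}>0$ if $(i,j)$ is an edge, and $\mathbf W_{ij}=0$ for all other $i\neq j$. Let $f_i:\mathbb R^n\to\mathbb R$ $(1\le i\le m)$ be twice continuously differentiable, with $L_{f_i}^g$-Lipschitz gradient, Lipschitz Hessian and compact sublevel sets, and let $L=\max_i L_{f_i}^g$. Put $f=\sum_i f_i$ and suppose that $\lambda_{\min}(\nabla^2 f(x))\neq 0$ at every $x$ with $\nabla f(x)=0$. For $\hat x=(\hat x_1,\dots,\hat x_m)\in(\mathbb R^n)^m$ put $F(\hat x)=\sum_i f_i(\hat x_i)$, $\hat{\mathbf W}=\mathbf W\otimes \mathbf I_n$ and $$Q_\alpha(\hat x)=F(\hat x)+\frac1{2\alpha}\sum_{i,j}(\mathbf I_m-\mathbf W)_{ij}\,\hat x_i^T\hat x_j .$$ For a function $h$ let $\mathcal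 X_h^*=\{x:\nabla h(x)=0,\ \nabla^2h(x)\succ0\}$ be its set of local minimizers. With $g_\alpha(\hat x)=\nabla F(\hat x)+\alpha^{-1}(\mathbf I-\hat{\mathbf W})\hat x$ let $$\mathcal L^1=\{\|g_\alpha\|\ge\epsilon\},\quad \mathcal L^2=\{\lambda_{\min}(\nabla^2F)\le-\gamma-\alpha^{-1}\},\quad \mathcal L^3=\{\hat x:\lambda_{\min}(\nabla^2F(\hat x))\ge\mu,\ \mathrm{dist}(\hat x,\hat{\mathcal X}')\le\delta\},$$ where $\hat{\mathcal X}'=\{g_\alpha=0,\ \lambda_{\min}(\nabla^2F)>0\}$. The *covering condition* at $\alpha$ with parameters $\epsilon>0$, $\gamma,\mu\in(0,L]$, $\delta>0$ is $\mathcal L^1\cup\mathcal L^2\cup\mathcal L^3=(\mathbb R^n)^m$. Given $\Delta_1>0$, call $\bar\alpha>0$ a *threshold* if for every $\alpha\in(0,\bar\alpha]$ at which the covering condition holds (with some parameters), every $\hat x^*\in\mathcal X^*_{Q_\alpha}$ satisfies $\mathrm{dist}(\hat x_i^*,\mathcal X_f^*)\le\Delta_1$ for all $i$. For $0<\zeta<1$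 let $$\hat\alpha(\Delta_1,\zeta)=\min\Big\{\bar\alpha,\ \frac{\sqrt2-1}{L},\ \frac{\lambda_{\min}(\mathbf W)}{L\max\{1,\log\zeta^{-1}\}}\Big\}.$$ NDGD with step-size $\alpha$ is $\hat x_i^{k+1}=\sum_j\mathbf W_{ij}\hat x_j^k-\alpha(\nabla f_i(\hat x_i^k)+\xi_i^k)$, $k\ge0$, from an arbitrary deterministic $\hat x^0$. **Theorem.** For every $\Delta_1>0$ a threshold exists. Let $\bar\alpha$ be any threshold. Fix $\epsilon,\gamma,\mu,\delta$, a bound $b$, and a probability law $\nu$ on $\mathbb R^n$ with mean zero and covariance $\sigma^2\mathbf I_n$, where $\sigma^2\le\lambda_{\min}(\mathbf W)\epsilon^2/(mn)$. There are constants $C_K,C_\Delta$ and functions $K(\alpha,\zeta)\in\mathbb N$, $\Delta_2(\alpha,\zeta)$, all depending only on the data fixed so far, such that for all $\zeta\in(0,1)$ and all $\alpha\in(0,\hat\alpha(\Delta_1,\zeta)]$ at which the covering condition holds with parameters $\epsilon,\gamma,\mu,\delta$, $$K(\alpha,\zeta)\le C_K\,\alpha^{-2}\max\{1,\log\zeta^{-1}\},\qquad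 \Delta_2(\alpha,\zeta)\le C_\Delta\sqrt{\alpha\max\{1,\log(\alpha^{-1}\zeta^{-1})\}},$$ and the following holds for every $\hat x^0$ and every noise $(\xi_i^k)$ that is i.i.d. over $i$ and $k$ with law $\nu$. If almost surely $|Q_\alpha(\hat x^k)|\le b$ for all $k$, then with probability at least $1-\zeta$, for $K=K(\alpha,\zeta)$ and $\Delta_2=\Delta_2(\alpha,\zeta)$: 1. $\mathrm{dist}(\hat x^K,\mathcal X^*_{Q_\alpha})\le\Delta_2$; 2. $\mathcal X^*_{Q_\alpha}$ has a point nearest to $\hat x^K$, and every such point $\hat x^*$ satisfies $\mathrm{dist}(\hat x^*_i,\mathcal X_f^*)\le\Delta_1$ for all $i$; 3. $\mathrm{dist}(\hat x_i^K,\mathcal X_f^*)\le\Delta_1+\Delta_2$ for all $i$. -/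

import Mathlib

open MeasureTheory ProbabilityTheory
open scoped NNReal ENNReal Gradient InnerProductSpace

noncomputable section

namespace NDGD

/-- The decision space `ℝⁿ` with its Euclidean norm. -/
abbrev Vec (n : ℕ) : Type := EuclideanSpace ℝ (Fin n)

/-- The stacked space `(ℝⁿ)ᵐ` with its Euclidean norm (the one of `ℝ^{mn}`). -/
abbrev Stack (m n : ℕ) : Type := PiLp 2 (fun _ : Fin m => Vec n)

/-- The smallest eigenvalue of an endomorphism of a real vector space. It is applied only to
symmetric endomorphisms of nonzero finite-dimensional spaces, which have finitely many, and at
least one, eigenvalues. -/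
def lamMin {V : Type*} [AddCommGroup V] [Module ℝ V] (T : V →ₗ[ℝ] V) : ℝ :=
  sInf {t : ℝ | Module.End.HasEigenvalue T t}

section Analysis

variable {V : Type*} [NormedAddCommGroup V] [InnerProductSpace ℝ V] [CompleteSpace V]

/-- The Hessian `∇²h(x)`, as an operator (the derivative of the gradient). -/
def hess (h : V → ℝ) (x : V) : V →L[ℝ] V := fderiv ℝ (gradient h) x

/-- The smallest eigenvalue of the Hessian, `λ_min(∇²h(x))`. -/
def lamMinHess (h : V → ℝ) (x : V) : ℝ := lamMin (hess h x : V →ₗ[ℝ] V)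

/-- The local minimizers in the sense `∇h(x) = 0`, `∇²h(x) ≻ 0`. -/
def localMinimizers (h : V → ℝ) : Set V :=
  {x | gradient h x = 0 ∧ ∀ v : V, v ≠ 0 → 0 < ⟪v, hess h x v⟫_ℝ}

/-- `x` is `r`-close to the set `Y`: `inf_{y ∈ Y} ‖x - y‖ ≤ r`, the infimum over the empty set
being `∞`. -/
def Close (r : ℝ) (x : V) (Y : Set V) : Prop := Metric.infEDist x Y ≤ ENNReal.ofReal r

/-- `y` is a point of `Y` nearest to `x`. -/
def IsNearest (x : V) (Y : Set V) (y : V) : Prop := y ∈ Y ∧ ∀ z ∈ Y, ‖x - y‖ ≤ ‖x - z‖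

end Analysis

section Problem

variable {m n : ℕ}

/-- The global objective `f(x) = ∑ᵢ fᵢ(x)`. -/
def total (f : Fin m → Vec n → ℝ) (x : Vec n) : ℝ := ∑ i, f i x

/-- The separable objective `F(x̂) = ∑ᵢ fᵢ(x̂ᵢ)`. -/
def stacked (f : Fin m → Vec n → ℝ) (x : Stack m n) : ℝ := ∑ i, f i (x i)

/-- The assumptions on the local objectives: local regularity of `f = ∑ᵢ fᵢ`, Lipschitz gradients,
Lipschitz Hessians and coercivity (properness is automatic for real-valued functions). -/
structure Objectives (f : Fin m → Vec n → ℝ) (Lg LH : Fin m → ℝ≥0) : Prop where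
  smooth : ∀ i, ContDiff ℝ 2 (f i)
  strict_saddle : ∀ x, gradient (total f) x = 0 →
    0 < lamMinHess (total f) x ∨ lamMinHess (total f) x < 0
  lipschitz_grad : ∀ i, LipschitzWith (Lg i) (gradient (f i))
  lipschitz_hess : ∀ i, LipschitzWith (LH i) (hess (f i))
  coercive : ∀ i, ∀ c : ℝ, IsCompact {x | f i x ≤ c}

/-- The constant `L_F^g = maxᵢ L_{fᵢ}^g`. -/
def maxLip (Lg : Fin m → ℝ≥0) : ℝ := ((Finset.univ.sup Lg : ℝ≥0) : ℝ)

/-- A mixing matrix consistent with the graph `G`: symmetric, doubly stochastic and strictly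
diagonally dominant. -/
structure Mixing (G : SimpleGraph (Fin m)) (W : Matrix (Fin m) (Fin m) ℝ) : Prop where
  diag_pos : ∀ i, 0 < W i i
  adj_pos : ∀ i j, G.Adj i j → 0 < W i j
  not_adj : ∀ i j, i ≠ j → ¬ G.Adj i j → W i j = 0
  symm : W.IsSymm
  stochastic : W ∈ doublyStochastic ℝ (Fin m)
  dominant : ∀ i, ∑ j ∈ Finset.univ.erase i, W i j < W i i

/-- `λ_min(W)`. -/
def lamMinMat (W : Matrix (Fin m) (Fin m) ℝ) : ℝ := lamMin (Matrix.toLin' W)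

/-- `Ŵ x̂`, where `Ŵ = W ⊗ Iₙ`. -/
def mix (W : Matrix (Fin m) (Fin m) ℝ) (x : Stack m n) : Stack m n :=
  WithLp.toLp 2 fun i => ∑ j, W i j • x j

/-- The auxiliary function
`Q_α(x̂) = ∑ᵢ fᵢ(x̂ᵢ) + (1 / 2α) ∑ᵢ ∑ⱼ (I - W)ᵢⱼ x̂ᵢᵀ x̂ⱼ`. -/
def aux (f : Fin m → Vec n → ℝ) (W : Matrix (Fin m) (Fin m) ℝ) (α : ℝ) (x : Stack m n) : ℝ :=
  ∑ i, f i (x i) + 1 / (2 * α) * ∑ i, ∑ j, (1 - W) i j * ⟪x i, x j⟫_ℝ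

/-- The vector `∇F(x̂) + α⁻¹ (I - Ŵ) x̂`. -/
def field (f : Fin m → Vec n → ℝ) (W : Matrix (Fin m) (Fin m) ℝ) (α : ℝ) (x : Stack m n) :
    Stack m n :=
  gradient (stacked f) x + α⁻¹ • (x - mix W x)

/-- The set `L¹` of points with a large gradient. -/
def regionOne (f : Fin m → Vec n → ℝ) (W : Matrix (Fin m) (Fin m) ℝ) (α ε : ℝ) :
    Set (Stack m n) :=
  {x | ε ≤ ‖field f W α x‖}

/-- The set `L²` of points with a sufficiently negative curvature. -/
def regionTwo (f : Fin m → Vec n → ℝ) (α γ : ℝ) : Set (Stack m n) :=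
  {x | lamMinHess (stacked f) x ≤ -γ - α⁻¹}

/-- The set `X̂'` that occurs in the definition of `L³`. -/
def minPrime (f : Fin m → Vec n → ℝ) (W : Matrix (Fin m) (Fin m) ℝ) (α : ℝ) :
    Set (Stack m n) :=
  {x | ‖field f W α x‖ = 0 ∧ 0 < lamMinHess (stacked f) x}

/-- The set `L³` of points of strong convexity near `X̂'`. -/
def regionThree (f : Fin m → Vec n → ℝ) (W : Matrix (Fin m) (Fin m) ℝ) (α μ δ : ℝ) :
    Set (Stack m n) :=
  {x | μ ≤ lamMinHess (stacked f) x ∧ Close δ x (minPrime f W α)}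

/-- The covering condition at the step-size `α` with parameters `ε, γ, μ, δ`; `L` is `L_F^g`. -/
structure Covering (f : Fin m → Vec n → ℝ) (W : Matrix (Fin m) (Fin m) ℝ) (L α ε γ μ δ : ℝ) :
    Prop where
  eps_pos : 0 < ε
  gamma_mem : γ ∈ Set.Ioc 0 L
  mu_mem : μ ∈ Set.Ioc 0 L
  delta_pos : 0 < δ
  cover : regionOne f W α ε ∪ regionTwo f α γ ∪ regionThree f W α μ δ = Set.univ

/-- `a` is an admissible threshold `ᾱ(Δ₁)`: for every step-size in `(0, a]` at which the covering
condition holds (with some parameters), all blocks of all local minimizers of `Q_α` are `Δ₁`-close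
to the local minimizers of `f`. -/
def IsThreshold (f : Fin m → Vec n → ℝ) (W : Matrix (Fin m) (Fin m) ℝ) (L Δ₁ a : ℝ) : Prop :=
  0 < a ∧ ∀ α ∈ Set.Ioc 0 a, (∃ ε γ μ δ, Covering f W L α ε γ μ δ) →
    ∀ x ∈ localMinimizers (aux f W α), ∀ i, Close Δ₁ (x i) (localMinimizers (total f))

/-- The largest admissible step-size `α̂(Δ₁, ζ)`, where `a` is the threshold `ᾱ(Δ₁)`. -/
def alphaHat (W : Matrix (Fin m) (Fin m) ℝ) (L a ζ : ℝ) : ℝ :=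
  min a (min ((√2 - 1) / L) (lamMinMat W / (L * max 1 (Real.log ζ⁻¹))))

/-- The iterates of NDGD from `x₀`, for a realization `ξ` of the noise. -/
def iterate (f : Fin m → Vec n → ℝ) (W : Matrix (Fin m) (Fin m) ℝ) (α : ℝ) (x₀ : Stack m n)
    (ξ : ℕ → Fin m → Vec n) : ℕ → Stack m n
  | 0 => x₀
  | k + 1 => WithLp.toLp 2 fun i =>
      ∑ j, W i j • iterate f W α x₀ ξ k j -
        α • (gradient (f i) (iterate f W α x₀ ξ k i) + ξ k i)

/-- `ν` is a probability law on `ℝⁿ` with mean zero and covariance matrix `σ² Iₙ`. -/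
structure NoiseLaw (ν : Measure (Vec n)) (σ : ℝ) : Prop where
  prob : IsProbabilityMeasure ν
  memLp : MemLp id 2 ν
  mean : ∫ v, v ∂ν = 0
  cov : ∀ a b : Fin n, ∫ v, v a * v b ∂ν = if a = b then σ ^ 2 else 0

/-- The noise vectors `ξᵢᵏ` are independent over all `i` and `k`, with common law `ν`. -/
structure IsNoise {Ω : Type*} [MeasurableSpace Ω] (P : Measure Ω) (ν : Measure (Vec n))
    (ξ : ℕ → Fin m → Ω → Vec n) : Prop where
  meas : ∀ k i, Measurable (ξ k i)
  law : ∀ k i, P.map (ξ k i) = ν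
  indep : iIndepFun (fun p : ℕ × Fin m => ξ p.1 p.2) P

end Problem

end NDGD

end

/-! For the admissible step-sizes `L ≤ 1/α`, so the eigenvalues of `∇²F` never reach `-γ - 1/α`: the
second region of the covering is empty, and `∇²F ≥ μ` wherever the gradient of `Q_α` is smaller than
`ε`. The consensus term is convex and `∇²F` is Lipschitz, so `∇²Q_α ≥ μ/2` on a ball of fixed radius
around each such point (`Covering.landscape`). Gradient descent contracts there, hence the map
sending a start to the limit of its descent is locally constant. The space is connected, so `Q_α`
has exactly one critical point, which is its global minimizer and its only local one
(`Landscape.crit_unique`, `Covering.exists_unique_minimizer`).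

A threshold exists by compactness (`exists_isThreshold`). Along `α → 0` the minimizers satisfy `F ≤
F(0)`, so they accumulate. Stationarity forces all blocks of a limit to be one point `w`. Summing
the blocks of the stationarity equation gives `∇f(w) = 0`, positive semidefiniteness passes to the
limit, and the nondegeneracy assumption makes `w` a local minimizer of `f`.

NDGD is gradient descent on `Q_α` with step `α` and additive noise, which must be bounded because
the iterates are. While the gradient is at least `ε`, the mean of `Q_α` drops by `αε²/4` per step;
relative to the upper bound on the objective this is a geometric decay, so order `α⁻¹ log ζ⁻¹` steps
reach `‖g‖ < ε` with high probability (`NoiseSeq.measure_forall_le_norm_grad`). From then on the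
noisy path is compared with the noiseless one from the same point: contraction keeps an exponential
moment of their squared distance, at scale `α`, below `2` (`NoiseSeq.lintegral_exp_deviation_le`),
and a union bound gives a distance of order `√(α log(1/(αζ)))`. The noiseless path converges
geometrically to the minimizer, and `α⁻²` further steps leave an error of order `α`.
`exists_guarantee` fixes the constants. -/

open Filter Topology Metric

noncomputable section

namespace NDGD

/-! ### Noiseless gradient descent and uniqueness of the critical point. -/

section Landscape

variable {V : Type*} [NormedAddCommGroup V] [InnerProductSpace ℝ V]

lemma norm_le_of_abs_inner_self_le (T : V →L[ℝ] V)
    (hs : ∀ u v, ⟪T u, v⟫_ℝ = ⟪u, T v⟫_ℝ) {c : ℝ} (hc : 0 ≤ c)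
    (h : ∀ v, |⟪v, T v⟫_ℝ| ≤ c * ‖v‖ ^ 2) : ‖T‖ ≤ c := by
  refine T.opNorm_le_bound hc fun u => ?_
  by_cases hu : u = 0
  · simp [hu]
  by_cases hT : T u = 0
  · simp only [hT, norm_zero]; positivity
  have hu' : 0 < ‖u‖ := norm_pos_iff.2 hu
  have hT' : 0 < ‖T u‖ := norm_pos_iff.2 hT
  -- Rescaling `T u` to the norm of `u` makes polarization combined with the parallelogram law
  -- sharp, with no loss in the constant.
  set v : V := (‖u‖ / ‖T u‖) • T u with hv
  have hnv : ‖v‖ = ‖u‖ := by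
    rw [hv, norm_smul, Real.norm_of_nonneg (by positivity)]
    field_simp
  have hpol : 4 * ⟪T u, v⟫_ℝ = ⟪u + v, T (u + v)⟫_ℝ - ⟪u - v, T (u - v)⟫_ℝ := by
    simp only [map_add, map_sub, inner_add_left, inner_add_right, inner_sub_left,
      inner_sub_right]
    rw [← hs u v, real_inner_comm (T u) v]
    ring
  have h1 := (abs_le.1 (h (u + v))).2
  have h2 := (abs_le.1 (h (u - v))).1
  have hpar := parallelogram_law_with_norm ℝ u v
  have h3 : ⟪T u, v⟫_ℝ = ‖u‖ * ‖T u‖ := by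
    rw [hv, inner_smul_right, real_inner_self_eq_norm_sq]
    field_simp
  rw [hnv] at hpar
  have h4 : 4 * (‖u‖ * ‖T u‖) ≤ c * (4 * ‖u‖ ^ 2) := by
    rw [← h3, hpol]
    nlinarith
  have h5 : ‖u‖ * ‖T u‖ ≤ ‖u‖ * (c * ‖u‖) := by nlinarith
  exact le_of_mul_le_mul_left h5 hu'

/-- A gradient step of size `s` along the vector field `g`. -/
def gradStep (g : V → V) (s : ℝ) (x : V) : V := x - s • g x

/-- A smooth function `Q` with gradient `g` and Hessian `H ≤ s⁻¹`, for which `H ≥ μ` holds on the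
`ρ`-neighbourhood of the set where `‖g‖ < ε`. -/
structure Landscape [CompleteSpace V] (Q : V → ℝ) (g : V → V) (H : V → V →L[ℝ] V)
    (s ε μ ρ : ℝ) : Prop where
  grad : ∀ x, HasGradientAt Q (g x) x
  deriv : ∀ x, HasFDerivAt g (H x) x
  symm : ∀ x u v, ⟪H x u, v⟫_ℝ = ⟪u, H x v⟫_ℝ
  step_pos : 0 < s
  smooth : ∀ x v, s * ⟪v, H x v⟫_ℝ ≤ ‖v‖ ^ 2
  eps_pos : 0 < ε
  mu_pos : 0 < μ
  rho_pos : 0 < ρ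
  step_mul_mu : s * μ ≤ 1
  convex : ∀ x, ‖g x‖ < ε → ∀ z, ‖z - x‖ ≤ ρ → ∀ v, μ * ‖v‖ ^ 2 ≤ ⟪v, H z v⟫_ℝ

namespace Landscape

variable [CompleteSpace V] {Q : V → ℝ} {g : V → V} {H : V → V →L[ℝ] V} {s ε μ ρ : ℝ}

lemma continuous_grad (h : Landscape Q g H s ε μ ρ) : Continuous g :=
  continuous_iff_continuousAt.2 fun x => (h.deriv x).continuousAt

lemma continuous_val (h : Landscape Q g H s ε μ ρ) : Continuous Q :=
  continuous_iff_continuousAt.2 fun x => (h.grad x).differentiableAt.continuousAt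

lemma continuous_gradStep (h : Landscape Q g H s ε μ ρ) : Continuous (gradStep g s) :=
  continuous_id.sub (h.continuous_grad.const_smul s)

lemma one_sub_nonneg (h : Landscape Q g H s ε μ ρ) : 0 ≤ 1 - s * μ := by
  linarith [h.step_mul_mu]

lemma one_sub_lt_one (h : Landscape Q g H s ε μ ρ) : 1 - s * μ < 1 := by
  linarith [mul_pos h.step_pos h.mu_pos]

/-- On the ball around `y` the step has derivative `1 - s H`, symmetric with quadratic form between
`0` and `1 - s μ`; the mean value inequality on this convex ball does the rest. Only the centre
needs a small gradient. -/
lemma contract (h : Landscape Q g H s ε μ ρ) {x y : V} (hy : ‖g y‖ < ε) (hxy : ‖x - y‖ ≤ ρ) :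
    ‖gradStep g s x - gradStep g s y‖ ≤ (1 - s * μ) * ‖x - y‖ := by
  have hmem : x ∈ closedBall y ρ := by rwa [mem_closedBall, dist_eq_norm]
  refine (convex_closedBall y ρ).norm_image_sub_le_of_norm_hasFDerivWithin_le
    (f' := fun z => ContinuousLinearMap.id ℝ V - s • H z) (fun z _ => ?_) (fun z hz => ?_)
    (mem_closedBall_self h.rho_pos.le) hmem
  · exact ((hasFDerivAt_id z).sub ((h.deriv z).const_smul s)).hasFDerivWithinAt
  · rw [mem_closedBall, dist_eq_norm] at hz
    refine norm_le_of_abs_inner_self_le _ (fun u v => ?_) h.one_sub_nonneg fun v => ?_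
    · simp [inner_sub_left, inner_sub_right, inner_smul_left, inner_smul_right, h.symm z u v]
    · have h1 := h.smooth z v
      have h2 := mul_le_mul_of_nonneg_left (h.convex y hy z hz v) h.step_pos.le
      have h3 : ⟪v, (ContinuousLinearMap.id ℝ V - s • H z) v⟫_ℝ
          = ‖v‖ ^ 2 - s * ⟪v, H z v⟫_ℝ := by
        simp [inner_sub_right, inner_smul_right]
      rw [h3, abs_of_nonneg (by linarith)]
      nlinarith

/-- Contraction is applied to `x` and its own image: consecutive displacements are `-s g`, so their
ratio is the ratio of the gradients. The condition `s ε ≤ ρ` keeps the image in the ball. -/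
lemma norm_grad_gradStep_le (h : Landscape Q g H s ε μ ρ) (hρ : s * ε ≤ ρ) {x : V}
    (hx : ‖g x‖ < ε) : ‖g (gradStep g s x)‖ ≤ (1 - s * μ) * ‖g x‖ := by
  have hd : gradStep g s x - x = -(s • g x) := by simp [gradStep]
  have hs := h.step_pos
  have h1 : ‖gradStep g s x - x‖ ≤ ρ := by
    rw [hd, norm_neg, norm_smul, Real.norm_of_nonneg hs.le]
    exact (mul_le_mul_of_nonneg_left hx.le hs.le).trans hρ
  have h2 := h.contract hx h1
  have hd' : gradStep g s (gradStep g s x) - gradStep g s x = -(s • g (gradStep g s x)) := by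
    simp [gradStep]
  rw [hd, hd', norm_neg, norm_neg, norm_smul, norm_smul, Real.norm_of_nonneg hs.le] at h2
  nlinarith

lemma norm_grad_iterate_le (h : Landscape Q g H s ε μ ρ) (hρ : s * ε ≤ ρ) {x : V}
    (hx : ‖g x‖ < ε) (k : ℕ) :
    ‖g ((gradStep g s)^[k] x)‖ ≤ ‖g x‖ * (1 - s * μ) ^ k := by
  induction k with
  | zero => simp
  | succ k ih =>
    have h1 : ‖g ((gradStep g s)^[k] x)‖ < ε :=
      lt_of_le_of_lt (ih.trans (mul_le_of_le_one_right (norm_nonneg _)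
        (pow_le_one₀ h.one_sub_nonneg h.one_sub_lt_one.le))) hx
    rw [Function.iterate_succ_apply', pow_succ]
    refine (h.norm_grad_gradStep_le hρ h1).trans ?_
    nlinarith [mul_le_mul_of_nonneg_left ih h.one_sub_nonneg]

lemma norm_grad_iterate_lt (h : Landscape Q g H s ε μ ρ) (hρ : s * ε ≤ ρ) {x : V}
    (hx : ‖g x‖ < ε) (k : ℕ) : ‖g ((gradStep g s)^[k] x)‖ < ε :=
  lt_of_le_of_lt ((h.norm_grad_iterate_le hρ hx k).trans
    (mul_le_of_le_one_right (norm_nonneg _)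
      (pow_le_one₀ h.one_sub_nonneg h.one_sub_lt_one.le))) hx

/-- Gradients, hence steps, decay geometrically; the tail of the series is `s ‖g x‖ / (s μ)` times
the power, which explains `ε / μ`. -/
lemma exists_tendsto_iterate (h : Landscape Q g H s ε μ ρ) (hρ : s * ε ≤ ρ) {x : V}
    (hx : ‖g x‖ < ε) : ∃ p, g p = 0 ∧
      Tendsto (fun k => (gradStep g s)^[k] x) atTop (𝓝 p) ∧
      ∀ k, ‖(gradStep g s)^[k] x - p‖ ≤ ε / μ * (1 - s * μ) ^ k := by
  have hs := h.step_pos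
  have hμ := h.mu_pos
  have hstep : ∀ k, dist ((gradStep g s)^[k] x) ((gradStep g s)^[k + 1] x)
      ≤ (s * ‖g x‖) * (1 - s * μ) ^ k := fun k => by
    rw [Function.iterate_succ_apply', dist_eq_norm, gradStep, sub_sub_cancel, norm_smul,
      Real.norm_of_nonneg hs.le, mul_assoc]
    exact mul_le_mul_of_nonneg_left (h.norm_grad_iterate_le hρ hx k) hs.le
  obtain ⟨p, hp⟩ := cauchySeq_tendsto_of_complete
    (cauchySeq_of_le_geometric _ _ h.one_sub_lt_one hstep)
  refine ⟨p, ?_, hp, fun k => ?_⟩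
  · have h1 : Tendsto (fun k => ‖g ((gradStep g s)^[k] x)‖) atTop (𝓝 ‖g p‖) :=
      ((h.continuous_grad.norm).tendsto p).comp hp
    have h2 : Tendsto (fun k => ‖g ((gradStep g s)^[k] x)‖) atTop (𝓝 0) := by
      refine squeeze_zero (fun _ => norm_nonneg _) (h.norm_grad_iterate_le hρ hx) ?_
      simpa using (tendsto_pow_atTop_nhds_zero_of_lt_one h.one_sub_nonneg
        h.one_sub_lt_one).const_mul ‖g x‖
    exact norm_eq_zero.1 (tendsto_nhds_unique h1 h2)
  · have h1 := dist_le_of_le_geometric_of_tendsto _ _ h.one_sub_lt_one hstep hp k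
    rw [dist_eq_norm] at h1
    refine h1.trans ?_
    have hpow : 0 ≤ (1 - s * μ) ^ k := pow_nonneg h.one_sub_nonneg k
    have h2 : s * ‖g x‖ * (1 - s * μ) ^ k / (1 - (1 - s * μ)) = ‖g x‖ / μ * (1 - s * μ) ^ k := by
      field_simp
      ring
    rw [h2]
    gcongr

/-- Along the segment the second derivative is at most `‖v‖² / s`. Subtracting this quadratic leaves
an antitone derivative that vanishes at `0` once the linear term is removed too, hence an antitone
function on `[0, ∞)`. -/
lemma descent (h : Landscape Q g H s ε μ ρ) (x v : V) :
    Q (x + v) ≤ Q x + ⟪g x, v⟫_ℝ + 1 / (2 * s) * ‖v‖ ^ 2 := by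
  have hs := h.step_pos
  have hline : ∀ t : ℝ, HasDerivAt (fun t : ℝ => x + t • v) v t := fun t => by
    simpa using ((hasDerivAt_id t).smul_const v).const_add x
  have hk : ∀ t : ℝ, HasDerivAt (fun t : ℝ => ⟪g (x + t • v), v⟫_ℝ - t * (1 / s * ‖v‖ ^ 2))
      (⟪H (x + t • v) v, v⟫_ℝ - 1 / s * ‖v‖ ^ 2) t := fun t => by
    have h1 := (h.deriv (x + t • v)).comp_hasDerivAt t (hline t)
    have h2 := h1.inner ℝ (hasDerivAt_const t v)
    convert! h2.sub ((hasDerivAt_id t).mul_const (1 / s * ‖v‖ ^ 2)) using 1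
    simp
  have hkanti : Antitone (fun t : ℝ => ⟪g (x + t • v), v⟫_ℝ - t * (1 / s * ‖v‖ ^ 2)) := by
    refine antitone_of_deriv_nonpos (fun t => (hk t).differentiableAt) fun t => ?_
    rw [(hk t).deriv, real_inner_comm]
    have h1 := h.smooth (x + t • v) v
    have h2 : ⟪v, H (x + t • v) v⟫_ℝ ≤ 1 / s * ‖v‖ ^ 2 := by
      rw [one_div, ← div_eq_inv_mul, le_div_iff₀ hs]; linarith
    linarith
  have hh : ∀ t : ℝ, HasDerivAt
      (fun t : ℝ => Q (x + t • v) - t * ⟪g x, v⟫_ℝ - t ^ 2 * (1 / (2 * s) * ‖v‖ ^ 2))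
      (⟪g (x + t • v), v⟫_ℝ - ⟪g x, v⟫_ℝ - t * (1 / s * ‖v‖ ^ 2)) t := fun t => by
    have h1 := (h.grad (x + t • v)).hasFDerivAt.comp_hasDerivAt t (hline t)
    have h2 := (h1.sub ((hasDerivAt_id t).mul_const ⟪g x, v⟫_ℝ)).sub
      ((hasDerivAt_pow 2 t).mul_const (1 / (2 * s) * ‖v‖ ^ 2))
    convert! h2 using 1
    simp only [InnerProductSpace.toDual_apply_apply, one_mul, Nat.cast_ofNat]
    field_simp
    ring
  have hanti : AntitoneOn
      (fun t : ℝ => Q (x + t • v) - t * ⟪g x, v⟫_ℝ - t ^ 2 * (1 / (2 * s) * ‖v‖ ^ 2))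
      (Set.Ici 0) := by
    refine antitoneOn_of_deriv_nonpos (convex_Ici 0)
      (fun t _ => (hh t).continuousAt.continuousWithinAt)
      (fun t _ => (hh t).differentiableAt.differentiableWithinAt) fun t ht => ?_
    rw [interior_Ici, Set.mem_Ioi] at ht
    rw [(hh t).deriv]
    have := hkanti ht.le
    simp only [zero_smul, add_zero, zero_mul, sub_zero] at this
    linarith
  have := hanti (Set.mem_Ici.2 le_rfl) (Set.mem_Ici.2 zero_le_one) zero_le_one
  simp only [one_smul, zero_smul, add_zero, zero_mul, sub_zero, one_mul, one_pow, ne_eq,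
    OfNat.ofNat_ne_zero, not_false_eq_true, zero_pow] at this
  linarith

lemma val_gradStep_le (h : Landscape Q g H s ε μ ρ) (x : V) :
    Q (gradStep g s x) ≤ Q x - s / 2 * ‖g x‖ ^ 2 := by
  have hs := h.step_pos
  have h1 := h.descent x (-(s • g x))
  rw [norm_neg, norm_smul, Real.norm_of_nonneg hs.le, inner_neg_right, inner_smul_right,
    real_inner_self_eq_norm_sq, ← sub_eq_add_neg] at h1
  have h2 : 1 / (2 * s) * (s * ‖g x‖) ^ 2 = s / 2 * ‖g x‖ ^ 2 := by field_simp
  rw [h2] at h1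
  rw [gradStep]
  linarith

lemma val_iterate_le (h : Landscape Q g H s ε μ ρ) (x : V) (k : ℕ) :
    Q ((gradStep g s)^[k] x) ≤ Q x := by
  induction k with
  | zero => simp
  | succ k ih =>
    rw [Function.iterate_succ_apply']
    have := h.val_gradStep_le ((gradStep g s)^[k] x)
    have hs := h.step_pos
    have : 0 ≤ s / 2 * ‖g ((gradStep g s)^[k] x)‖ ^ 2 := by positivity
    linarith

/-- Every step from a point with `‖g‖ ≥ ε` costs at least `s ε² / 2` of an objective bounded below.
-/
lemma exists_iterate_norm_grad_lt (h : Landscape Q g H s ε μ ρ) {c : ℝ} (hc : ∀ x, c ≤ Q x)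
    (x : V) : ∃ k, ‖g ((gradStep g s)^[k] x)‖ < ε := by
  by_contra! hcon
  have hs := h.step_pos
  have hε := h.eps_pos
  have h1 : ∀ k : ℕ, Q ((gradStep g s)^[k] x) ≤ Q x - k * (s / 2 * ε ^ 2) := fun k => by
    induction k with
    | zero => simp
    | succ k ih =>
      rw [Function.iterate_succ_apply']
      have h2 := h.val_gradStep_le ((gradStep g s)^[k] x)
      have h3 : s / 2 * ε ^ 2 ≤ s / 2 * ‖g ((gradStep g s)^[k] x)‖ ^ 2 := by
        gcongr
        exact hcon k
      push_cast
      linarith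
  obtain ⟨k, hk⟩ := exists_nat_gt ((Q x - c) / (s / 2 * ε ^ 2))
  rw [div_lt_iff₀ (by positivity)] at hk
  linarith [h1 k, hc ((gradStep g s)^[k] x)]

lemma exists_tendsto_gradStep (h : Landscape Q g H s ε μ ρ) (hρ : s * ε ≤ ρ) {c : ℝ}
    (hc : ∀ x, c ≤ Q x) (x : V) :
    ∃ p, g p = 0 ∧ Tendsto (fun k => (gradStep g s)^[k] x) atTop (𝓝 p) := by
  obtain ⟨k, hk⟩ := h.exists_iterate_norm_grad_lt hc x
  obtain ⟨p, hp, ht, -⟩ := h.exists_tendsto_iterate hρ hk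
  refine ⟨p, hp, (tendsto_add_atTop_iff_nat k).1 ?_⟩
  simpa only [Function.iterate_add_apply] using ht

lemma exists_crit_val_le (h : Landscape Q g H s ε μ ρ) (hρ : s * ε ≤ ρ) {c : ℝ}
    (hc : ∀ x, c ≤ Q x) (x : V) : ∃ p, g p = 0 ∧ Q p ≤ Q x := by
  obtain ⟨p, hp, ht⟩ := h.exists_tendsto_gradStep hρ hc x
  exact ⟨p, hp, le_of_tendsto ((h.continuous_val.tendsto p).comp ht)
    (Eventually.of_forall fun k => h.val_iterate_le x k)⟩

/-- The orbit of `y` keeps a small gradient, so each of its points can serve as the centre of the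
next contraction. -/
lemma iterate_contract (h : Landscape Q g H s ε μ ρ) (hρ : s * ε ≤ ρ) {x y : V}
    (hy : ‖g y‖ < ε) (hxy : ‖x - y‖ ≤ ρ) (k : ℕ) :
    ‖(gradStep g s)^[k] x - (gradStep g s)^[k] y‖ ≤ ρ * (1 - s * μ) ^ k := by
  induction k with
  | zero => simpa using hxy
  | succ k ih =>
    rw [Function.iterate_succ_apply', Function.iterate_succ_apply', pow_succ]
    have h1 := h.contract (h.norm_grad_iterate_lt hρ hy k) (ih.trans
      (mul_le_of_le_one_right h.rho_pos.le
        (pow_le_one₀ h.one_sub_nonneg h.one_sub_lt_one.le)))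
    nlinarith [mul_le_mul_of_nonneg_left ih h.one_sub_nonneg]

/-- Descent from any start converges; call the limit `Φ`. Its fixed points include all critical
points, and it is locally constant on a connected space, hence constant. -/
theorem crit_unique (h : Landscape Q g H s ε μ ρ) (hρ : s * ε ≤ ρ) {c : ℝ}
    (hc : ∀ x, c ≤ Q x) {p q : V} (hp : g p = 0) (hq : g q = 0) : p = q := by
  choose Φ _ hΦ' using h.exists_tendsto_gradStep hρ hc
  have hfix : ∀ p, g p = 0 → Φ p = p := fun p hp => by
    have h1 : ∀ k, (gradStep g s)^[k] p = p := fun k =>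
      Function.iterate_fixed (by simp [gradStep, hp]) k
    have h2 := hΦ' p
    simp only [h1] at h2
    exact tendsto_nhds_unique h2 tendsto_const_nhds
  have hloc : IsLocallyConstant Φ := by
    refine (IsLocallyConstant.iff_eventually_eq Φ).2 fun x => ?_
    -- After finitely many steps the orbit of `x` has a small gradient; by continuity nearby starts
    -- are then within `ρ` of it, and contraction merges the two orbits.
    obtain ⟨k, hk⟩ := h.exists_iterate_norm_grad_lt hc x
    have hcont : Continuous (gradStep g s)^[k] := h.continuous_gradStep.iterate k
    filter_upwards [hcont.continuousAt.preimage_mem_nhds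
      (closedBall_mem_nhds ((gradStep g s)^[k] x) h.rho_pos)] with x' hx'
    rw [Set.mem_preimage, mem_closedBall, dist_eq_norm] at hx'
    have h1 : Tendsto (fun j => (gradStep g s)^[j] ((gradStep g s)^[k] x')
        - (gradStep g s)^[j] ((gradStep g s)^[k] x)) atTop (𝓝 0) := by
      refine squeeze_zero_norm (h.iterate_contract hρ hk hx') ?_
      simpa using (tendsto_pow_atTop_nhds_zero_of_lt_one h.one_sub_nonneg
        h.one_sub_lt_one).const_mul ρ
    have h2 := ((tendsto_add_atTop_iff_nat k).2 (hΦ' x')).sub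
      ((tendsto_add_atTop_iff_nat k).2 (hΦ' x))
    simp only [Function.iterate_add_apply] at h2
    exact sub_eq_zero.1 (tendsto_nhds_unique h2 h1)
  rw [← hfix p hp, ← hfix q hq]
  exact hloc.apply_eq_of_isPreconnected isPreconnected_univ (Set.mem_univ _) (Set.mem_univ _)

end Landscape

end Landscape

/-! ### The smallest eigenvalue as a bound on the quadratic form. -/

section Eigenvalues

variable {V : Type*} [NormedAddCommGroup V] [InnerProductSpace ℝ V] [FiniteDimensional ℝ V]

lemma lamMin_mul_norm_sq_le {T : V →ₗ[ℝ] V} (hT : T.IsSymmetric) (v : V) :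
    lamMin T * ‖v‖ ^ 2 ≤ ⟪v, T v⟫_ℝ := by
  set e := hT.eigenvectorBasis rfl
  have h1 : ∀ i, lamMin T ≤ hT.eigenvalues rfl i := fun i =>
    csInf_le (Module.End.finite_hasEigenvalue T).bddBelow
      (by simpa using hT.hasEigenvalue_eigenvalues rfl i)
  rw [← e.sum_sq_norm_inner_right v, ← e.sum_inner_mul_inner v (T v), Finset.mul_sum]
  refine Finset.sum_le_sum fun i _ => ?_
  rw [← hT (e i) v, hT.apply_eigenvectorBasis rfl i, inner_smul_left, real_inner_comm v (e i)]
  simp only [Real.norm_eq_abs, sq_abs, RCLike.ofReal_real_eq_id, id_eq, conj_trivial]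
  have := mul_le_mul_of_nonneg_right (h1 i) (sq_nonneg ⟪v, e i⟫_ℝ)
  linarith

/-- Each eigenvalue is tested on an eigenvector. Nontriviality makes the spectrum nonempty, so that
the infimum is not the default value. -/
lemma le_lamMin [Nontrivial V] {T : V →ₗ[ℝ] V} (hT : T.IsSymmetric) {c : ℝ}
    (h : ∀ v, c * ‖v‖ ^ 2 ≤ ⟪v, T v⟫_ℝ) : c ≤ lamMin T := by
  refine le_csInf ?_ fun t ht => ?_
  · have hpos : 0 < Module.finrank ℝ V := Module.finrank_pos
    exact ⟨_, by simpa using hT.hasEigenvalue_eigenvalues rfl ⟨0, hpos⟩⟩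
  · obtain ⟨v, hv⟩ := Module.End.HasEigenvalue.exists_hasEigenvector ht
    have h1 := h v
    rw [hv.apply_eq_smul, inner_smul_right, real_inner_self_eq_norm_sq] at h1
    exact le_of_mul_le_mul_right h1 (pow_pos (norm_pos_iff.2 hv.2) 2)

end Eigenvalues

/-! ### Gradient and Hessian of twice continuously differentiable functions. -/

section Hessian

variable {V : Type*} [NormedAddCommGroup V] [InnerProductSpace ℝ V] [CompleteSpace V]
  {f : V → ℝ}

lemma hasGradientAt_of_contDiff (hf : ContDiff ℝ 2 f) (x : V) :
    HasGradientAt f (gradient f x) x :=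
  (hf.differentiable (by norm_num) x).hasGradientAt

lemma contDiff_gradient (hf : ContDiff ℝ 2 f) : ContDiff ℝ 1 (gradient f) :=
  (InnerProductSpace.toDual ℝ V).symm.contDiff.comp (hf.fderiv_right (m := 1) (by norm_num))

lemma hasFDerivAt_gradient (hf : ContDiff ℝ 2 f) (x : V) :
    HasFDerivAt (gradient f) (hess f x) x :=
  ((contDiff_gradient hf).differentiable (by norm_num) x).hasFDerivAt

lemma continuous_hess (hf : ContDiff ℝ 2 f) : Continuous (hess f) :=
  (contDiff_gradient hf).continuous_fderiv (by norm_num)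

/-- Differentiate `y ↦ ⟪∇f(y), v⟫ = Df(y) v` in its two forms. This brings symmetry of the Hessian
back to that of second derivatives. -/
lemma inner_hess_left (hf : ContDiff ℝ 2 f) (x u v : V) :
    ⟪hess f x u, v⟫_ℝ = fderiv ℝ (fderiv ℝ f) x u v := by
  have h1 : HasFDerivAt (fun y => ⟪gradient f y, v⟫_ℝ)
      ((innerSL ℝ v).comp (hess f x)) x := by
    have := ((innerSL ℝ v).hasFDerivAt (x := gradient f x)).comp x (hasFDerivAt_gradient hf x)
    refine this.congr_of_eventuallyEq (Eventually.of_forall fun y => ?_)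
    simp
  have h2 : HasFDerivAt (fun y => fderiv ℝ f y v)
      ((fderiv ℝ (fderiv ℝ f) x).flip v) x := by
    have h3 : DifferentiableAt ℝ (fderiv ℝ f) x :=
      (hf.fderiv_right (m := 1) (by norm_num)).differentiable (by norm_num) x
    simpa using h3.hasFDerivAt.clm_apply (hasFDerivAt_const v x)
  have h4 : (fun y => ⟪gradient f y, v⟫_ℝ) = fun y => fderiv ℝ f y v := by
    funext y
    exact inner_gradient_left
  rw [h4] at h1
  have := congrArg (fun L : V →L[ℝ] ℝ => L u) (h1.unique h2)
  simpa [real_inner_comm] using this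

lemma hess_symm (hf : ContDiff ℝ 2 f) (x u v : V) :
    ⟪hess f x u, v⟫_ℝ = ⟪u, hess f x v⟫_ℝ := by
  rw [real_inner_comm _ u, inner_hess_left hf, inner_hess_left hf]
  exact (hf.contDiffAt.isSymmSndFDerivAt (by simp)).eq u v

lemma hess_isSymmetric (hf : ContDiff ℝ 2 f) (x : V) :
    ((hess f x : V →L[ℝ] V) : V →ₗ[ℝ] V).IsSymmetric := fun u v => hess_symm hf x u v

lemma norm_hess_le {L : ℝ≥0} (hL : LipschitzWith L (gradient f)) (x : V) :
    ‖hess f x‖ ≤ L := norm_fderiv_le_of_lipschitz ℝ hL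

lemma inner_hess_le {L : ℝ≥0} (hL : LipschitzWith L (gradient f)) (x v : V) :
    |⟪v, hess f x v⟫_ℝ| ≤ L * ‖v‖ ^ 2 := by
  refine (abs_real_inner_le_norm _ _).trans ?_
  have := (hess f x).le_of_opNorm_le (norm_hess_le hL x) v
  nlinarith [norm_nonneg v]

end Hessian

/-! ### The separable objective on the stacked space. -/

section Stacked

variable {m n : ℕ} {f : Fin m → Vec n → ℝ}

lemma norm_sq_stack (x : Stack m n) : ‖x‖ ^ 2 = ∑ i, ‖x i‖ ^ 2 :=
  PiLp.norm_sq_eq_of_L2 _ x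

lemma inner_stack (x y : Stack m n) : ⟪x, y⟫_ℝ = ∑ i, ⟪x i, y i⟫_ℝ :=
  PiLp.inner_apply x y

lemma norm_block_le (x : Stack m n) (i : Fin m) : ‖x i‖ ≤ ‖x‖ := PiLp.norm_apply_le x i

/-- The projection to the `i`-th block. -/
def blockL (i : Fin m) : Stack m n →L[ℝ] Vec n := PiLp.proj 2 (fun _ : Fin m => Vec n) i

@[simp] lemma blockL_apply (i : Fin m) (x : Stack m n) : blockL i x = x i := rfl

lemma contDiff_block (i : Fin m) {k : WithTop ℕ∞} :
    ContDiff ℝ k (fun x : Stack m n => x i) :=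
  (PiLp.proj 2 (fun _ : Fin m => Vec n) i : Stack m n →L[ℝ] Vec n).contDiff

lemma contDiff_stacked (hf : ∀ i, ContDiff ℝ 2 (f i)) : ContDiff ℝ 2 (stacked f) :=
  ContDiff.sum fun i _ => (hf i).comp (contDiff_block i)

lemma contDiff_total (hf : ∀ i, ContDiff ℝ 2 (f i)) : ContDiff ℝ 2 (total f) :=
  ContDiff.sum fun i _ => hf i

lemma gradient_stacked (hf : ∀ i, ContDiff ℝ 2 (f i)) (x : Stack m n) :
    gradient (stacked f) x = WithLp.toLp 2 fun i => gradient (f i) (x i) := by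
  refine HasGradientAt.gradient ?_
  rw [hasGradientAt_iff_hasFDerivAt]
  have h1 : HasFDerivAt (stacked f) (∑ i, (InnerProductSpace.toDual ℝ (Vec n)
      (gradient (f i) (x i))).comp (PiLp.proj 2 (fun _ : Fin m => Vec n) i)) x :=
    HasFDerivAt.fun_sum fun i _ => (hasGradientAt_of_contDiff (hf i) (x i)).hasFDerivAt.comp x
      (PiLp.proj 2 (fun _ : Fin m => Vec n) i).hasFDerivAt
  convert! h1 using 1
  ext v
  simp [inner_stack]

/-- The chain rule on both sides of `P ∘ G = g ∘ P`. With `P` a block projection it reads off the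
blocks of the stacked Hessian. -/
lemma fderiv_intertwine {E F : Type*} [NormedAddCommGroup E] [NormedSpace ℝ E]
    [NormedAddCommGroup F] [NormedSpace ℝ F] (P : E →L[ℝ] F) {G : E → E} {g : F → F}
    {G' : E →L[ℝ] E} {g' : F →L[ℝ] F} {x : E} (hG : HasFDerivAt G G' x)
    (hg : HasFDerivAt g g' (P x)) (h : ∀ y, P (G y) = g (P y)) (v : E) :
    P (G' v) = g' (P v) := by
  have h1 : HasFDerivAt (fun y => P (G y)) (P.comp G') x := P.hasFDerivAt.comp x hG
  have h2 : HasFDerivAt (fun y => g (P y)) (g'.comp P) x := hg.comp x P.hasFDerivAt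
  rw [funext h] at h1
  exact DFunLike.congr_fun (h1.unique h2) v

lemma hess_stacked_apply (hf : ∀ i, ContDiff ℝ 2 (f i)) (x v : Stack m n) (i : Fin m) :
    hess (stacked f) x v i = hess (f i) (x i) (v i) :=
  fderiv_intertwine (blockL i) (hasFDerivAt_gradient (contDiff_stacked hf) x)
    (hasFDerivAt_gradient (hf i) (x i)) (fun y => by rw [gradient_stacked hf]; rfl) v

lemma inner_hess_stacked (hf : ∀ i, ContDiff ℝ 2 (f i)) (x v : Stack m n) :
    ⟪v, hess (stacked f) x v⟫_ℝ = ∑ i, ⟪v i, hess (f i) (x i) (v i)⟫_ℝ := by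
  rw [inner_stack]
  simp [hess_stacked_apply hf]

lemma gradient_total (hf : ∀ i, ContDiff ℝ 2 (f i)) (x : Vec n) :
    gradient (total f) x = ∑ i, gradient (f i) x := by
  refine HasGradientAt.gradient ?_
  rw [hasGradientAt_iff_hasFDerivAt, map_sum]
  exact HasFDerivAt.fun_sum fun i _ => (hasGradientAt_of_contDiff (hf i) x).hasFDerivAt

lemma hess_total (hf : ∀ i, ContDiff ℝ 2 (f i)) (x : Vec n) :
    hess (total f) x = ∑ i, hess (f i) x := by
  have h1 : gradient (total f) = fun y => ∑ i, gradient (f i) y := funext (gradient_total hf)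
  rw [hess, h1]
  exact (HasFDerivAt.fun_sum fun i _ => hasFDerivAt_gradient (hf i) x).fderiv

end Stacked

/-! ### The mixing operator and its quadratic form. -/

section Mixing

variable {m n : ℕ} (W : Matrix (Fin m) (Fin m) ℝ)

@[simp] lemma mix_apply (x : Stack m n) (i : Fin m) : mix W x i = ∑ j, W i j • x j := rfl

/-- The operator `I - W ⊗ Iₙ`. -/
def lapLinear : Stack m n →ₗ[ℝ] Stack m n where
  toFun x := x - mix W x
  map_add' x y := PiLp.ext fun i => by
    simp only [mix_apply, PiLp.add_apply, PiLp.sub_apply, smul_add, Finset.sum_add_distrib]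
    abel
  map_smul' c x := PiLp.ext fun i => by
    simp only [mix_apply, PiLp.smul_apply, PiLp.sub_apply, RingHom.id_apply, Finset.smul_sum,
      smul_comm c, smul_sub]

lemma continuous_mix : Continuous (mix (n := n) W) :=
  (PiLp.continuous_toLp 2 _).comp (continuous_pi fun i =>
    continuous_finsetSum _ fun j _ => (PiLp.continuous_apply 2 _ j).const_smul (W i j))

/-- The operator `I - W ⊗ Iₙ`, as a continuous linear map. -/
def lapL : Stack m n →L[ℝ] Stack m n where
  toLinearMap := lapLinear W
  cont := continuous_id.sub (continuous_mix W)

@[simp] lemma lapL_apply (x : Stack m n) : lapL W x = x - mix W x := rfl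

variable {W}

lemma inner_mix (x y : Stack m n) :
    ⟪x, mix W y⟫_ℝ = ∑ i, ∑ j, W i j * ⟪x i, y j⟫_ℝ := by
  simp [inner_stack, inner_sum, inner_smul_right]

lemma inner_mix_symm (hW : W.IsSymm) (x y : Stack m n) :
    ⟪mix W x, y⟫_ℝ = ⟪x, mix W y⟫_ℝ := by
  rw [real_inner_comm, inner_mix, inner_mix, Finset.sum_comm]
  refine Finset.sum_congr rfl fun i _ => Finset.sum_congr rfl fun j _ => ?_
  rw [hW.apply i j, real_inner_comm]

/-- The Dirichlet form of the weighted graph: expanding the squares, the diagonal terms collapse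
because rows and columns sum to one. Both convexity and the consensus argument rest on it. -/
lemma inner_sub_mix (hW' : W ∈ doublyStochastic ℝ (Fin m)) (x : Stack m n) :
    ⟪x, x - mix W x⟫_ℝ = 1 / 2 * ∑ i, ∑ j, W i j * ‖x i - x j‖ ^ 2 := by
  have hrow : ∀ i, ∑ j, W i j = 1 := (mem_doublyStochastic_iff_sum.1 hW').2.1
  have hcol : ∀ j, ∑ i, W i j = 1 := (mem_doublyStochastic_iff_sum.1 hW').2.2
  have h1 : ∑ i, ∑ j, W i j * ‖x i‖ ^ 2 = ‖x‖ ^ 2 := by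
    simp [← Finset.sum_mul, hrow, norm_sq_stack]
  have h2 : ∑ i, ∑ j, W i j * ‖x j‖ ^ 2 = ‖x‖ ^ 2 := by
    rw [Finset.sum_comm]
    simp [← Finset.sum_mul, hcol, norm_sq_stack]
  have h3 : ∑ i, ∑ j, W i j * ‖x i - x j‖ ^ 2
      = ∑ i, ∑ j, W i j * ‖x i‖ ^ 2 + ∑ i, ∑ j, W i j * ‖x j‖ ^ 2
        - 2 * ∑ i, ∑ j, W i j * ⟪x i, x j⟫_ℝ := by
    simp only [Finset.mul_sum, ← Finset.sum_add_distrib, ← Finset.sum_sub_distrib]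
    refine Finset.sum_congr rfl fun i _ => Finset.sum_congr rfl fun j _ => ?_
    rw [norm_sub_sq_real]
    ring
  rw [h3, h1, h2, inner_sub_right, real_inner_self_eq_norm_sq, inner_mix]
  ring

lemma inner_sub_mix_nonneg (hW' : W ∈ doublyStochastic ℝ (Fin m))
    (x : Stack m n) : 0 ≤ ⟪x, x - mix W x⟫_ℝ := by
  rw [inner_sub_mix hW']
  have := (mem_doublyStochastic_iff_sum.1 hW').1
  exact mul_nonneg (by norm_num) (Finset.sum_nonneg fun i _ => Finset.sum_nonneg fun j _ =>
    mul_nonneg (this i j) (sq_nonneg _))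

/-- Passage from plain coordinate vectors to the Euclidean space, where the spectral theorem
applies. -/
lemma lamMinMat_eq : lamMinMat W = lamMin (Matrix.toEuclideanLin W) := by
  have : ∀ t, Module.End.HasEigenvalue (Matrix.toLin' W) t ↔
      Module.End.HasEigenvalue (Matrix.toEuclideanLin W) t := fun t => by
    constructor
    · intro h
      obtain ⟨v, hv⟩ := h.exists_hasEigenvector
      refine Module.End.hasEigenvalue_of_hasEigenvector (x := WithLp.toLp 2 v)
        ⟨Module.End.mem_eigenspace_iff.2 ?_, fun h0 => hv.2 (by simpa using h0)⟩
      have := hv.apply_eq_smul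
      rw [Matrix.toLin'_apply] at this
      rw [Matrix.toLpLin_toLp, Matrix.toLin'_apply, this]
      rfl
    · intro h
      obtain ⟨v, hv⟩ := h.exists_hasEigenvector
      refine Module.End.hasEigenvalue_of_hasEigenvector (x := WithLp.ofLp v)
        ⟨Module.End.mem_eigenspace_iff.2 ?_, fun h0 => hv.2 (by simpa using h0)⟩
      have := hv.apply_eq_smul
      rw [Matrix.toLpLin_apply] at this
      rw [Matrix.toLin'_apply]
      exact congrArg WithLp.ofLp this
  simp only [lamMinMat, lamMin, this]

/-- `W ⊗ Iₙ` acts on each of the `n` coordinates separately as `W`; the scalar bounds are summed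
over the coordinates. -/
lemma lamMinMat_mul_le (hW : W.IsSymm) (x : Stack m n) :
    lamMinMat W * ‖x‖ ^ 2 ≤ ⟪x, mix W x⟫_ℝ := by
  have hsymm : (Matrix.toEuclideanLin W).IsSymmetric := by
    rw [Matrix.isSymmetric_toEuclideanLin_iff]
    simpa [Matrix.IsHermitian, Matrix.conjTranspose_eq_transpose_of_trivial] using hW.eq
  rw [lamMinMat_eq]
  have h1 : ∀ c : Fin n, lamMin (Matrix.toEuclideanLin W) * ∑ i, x i c ^ 2
      ≤ ∑ i, ∑ j, W i j * (x i c * x j c) := fun c => by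
    have := lamMin_mul_norm_sq_le hsymm (WithLp.toLp 2 fun i => x i c)
    rw [EuclideanSpace.norm_sq_eq] at this
    refine (by simpa using this : _ ≤ _).trans (le_of_eq ?_)
    simp only [PiLp.inner_apply, Matrix.mulVec, dotProduct]
    refine Finset.sum_congr rfl fun i _ => ?_
    simp only [RCLike.inner_apply, conj_trivial, Finset.sum_mul]
    exact Finset.sum_congr rfl fun j _ => by ring
  have h2 : ‖x‖ ^ 2 = ∑ c, ∑ i, x i c ^ 2 := by
    rw [norm_sq_stack, Finset.sum_comm]
    simp [EuclideanSpace.norm_sq_eq]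
  have h3 : ⟪x, mix W x⟫_ℝ = ∑ c, ∑ i, ∑ j, W i j * (x i c * x j c) := by
    rw [inner_mix, Finset.sum_comm]
    simp_rw [Finset.sum_comm (s := (Finset.univ : Finset (Fin n)))]
    rw [Finset.sum_comm]
    refine Finset.sum_congr rfl fun i _ => Finset.sum_congr rfl fun j _ => ?_
    rw [PiLp.inner_apply, Finset.mul_sum]
    refine Finset.sum_congr rfl fun c _ => ?_
    simp [mul_comm]
  rw [h2, h3, Finset.mul_sum]
  exact Finset.sum_le_sum fun c _ => h1 c

end Mixing

/-! ### Adding a quadratic form to a function. -/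

section Quadratic

variable {V : Type*} [NormedAddCommGroup V] [InnerProductSpace ℝ V] [CompleteSpace V]
  {f : V → ℝ} {A : V →L[ℝ] V}

lemma hasGradientAt_add_quadratic (hf : ContDiff ℝ 2 f) (hA : ∀ u v, ⟪A u, v⟫_ℝ = ⟪u, A v⟫_ℝ)
    (c : ℝ) (x : V) :
    HasGradientAt (fun x => f x + c / 2 * ⟪x, A x⟫_ℝ) (gradient f x + c • A x) x := by
  rw [hasGradientAt_iff_hasFDerivAt]
  have h1 : HasFDerivAt (fun x => ⟪x, A x⟫_ℝ) _ x :=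
    (hasFDerivAt_id x).inner ℝ A.hasFDerivAt
  convert! (hasGradientAt_of_contDiff hf x).hasFDerivAt.add (h1.const_mul (c / 2)) using 1
  ext v
  simp [← hA, real_inner_comm v]
  ring

lemma gradient_add_quadratic (hf : ContDiff ℝ 2 f)
    (hA : ∀ u v, ⟪A u, v⟫_ℝ = ⟪u, A v⟫_ℝ) (c : ℝ) :
    gradient (fun x => f x + c / 2 * ⟪x, A x⟫_ℝ) = fun x => gradient f x + c • A x :=
  funext fun x => (hasGradientAt_add_quadratic hf hA c x).gradient

omit [CompleteSpace V] in
lemma contDiff_add_quadratic (hf : ContDiff ℝ 2 f) (c : ℝ) :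
    ContDiff ℝ 2 (fun x => f x + c / 2 * ⟪x, A x⟫_ℝ) :=
  hf.add (contDiff_const.mul (contDiff_id.inner ℝ A.contDiff))

lemma hess_add_quadratic (hf : ContDiff ℝ 2 f)
    (hA : ∀ u v, ⟪A u, v⟫_ℝ = ⟪u, A v⟫_ℝ) (c : ℝ) (x v : V) :
    hess (fun x => f x + c / 2 * ⟪x, A x⟫_ℝ) x v = hess f x v + c • A v := by
  rw [hess, gradient_add_quadratic hf hA]
  exact DFunLike.congr_fun
    ((hasFDerivAt_gradient hf x).add (A.hasFDerivAt.const_smul c)).fderiv v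

end Quadratic

/-! ### The auxiliary function `Q_α` and bounds from the objectives. -/

section Aux

variable {m n : ℕ} {f : Fin m → Vec n → ℝ} {W : Matrix (Fin m) (Fin m) ℝ} {α : ℝ}

lemma aux_eq (x : Stack m n) :
    aux f W α x = stacked f x + α⁻¹ / 2 * ⟪x, x - mix W x⟫_ℝ := by
  have h1 : ∑ i, ∑ j, (1 - W) i j * ⟪x i, x j⟫_ℝ = ⟪x, x - mix W x⟫_ℝ := by
    rw [inner_sub_right, inner_mix, inner_stack, ← Finset.sum_sub_distrib]
    refine Finset.sum_congr rfl fun i _ => ?_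
    simp [Matrix.sub_apply, sub_mul, Finset.sum_sub_distrib, Matrix.one_apply]
  rw [aux, h1, stacked]
  congr 2
  rw [one_div, mul_inv, div_eq_mul_inv, mul_comm]

lemma aux_eq_fun :
    aux f W α = fun x => stacked f x + α⁻¹ / 2 * ⟪x, lapL (n := n) W x⟫_ℝ := funext aux_eq

lemma lapL_symm (hW : W.IsSymm) (u v : Stack m n) : ⟪lapL W u, v⟫_ℝ = ⟪u, lapL W v⟫_ℝ := by
  rw [lapL_apply, lapL_apply, inner_sub_left, inner_sub_right, inner_mix_symm hW]

lemma contDiff_aux (hf : ∀ i, ContDiff ℝ 2 (f i)) : ContDiff ℝ 2 (aux f W α) := by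
  rw [aux_eq_fun]
  exact contDiff_add_quadratic (contDiff_stacked hf) α⁻¹

lemma gradient_aux (hf : ∀ i, ContDiff ℝ 2 (f i)) (hW : W.IsSymm) :
    gradient (aux f W α) = field f W α := by
  rw [aux_eq_fun]
  exact gradient_add_quadratic (contDiff_stacked hf) (lapL_symm hW) α⁻¹

lemma inner_hess_aux (hf : ∀ i, ContDiff ℝ 2 (f i)) (hW : W.IsSymm) (x v : Stack m n) :
    ⟪v, hess (aux f W α) x v⟫_ℝ
      = ⟪v, hess (stacked f) x v⟫_ℝ + α⁻¹ * ⟪v, v - mix W v⟫_ℝ := by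
  have h : hess (aux f W α) x v = hess (stacked f) x v + α⁻¹ • lapL W v := by
    rw [aux_eq_fun]
    exact hess_add_quadratic (contDiff_stacked hf) (lapL_symm hW) α⁻¹ x v
  rw [h, inner_add_right, inner_smul_right, lapL_apply]

lemma stacked_le_aux (hW : W ∈ doublyStochastic ℝ (Fin m)) (hα : 0 < α) (x : Stack m n) :
    stacked f x ≤ aux f W α x := by
  rw [aux_eq]
  have := inner_sub_mix_nonneg hW x
  have : 0 ≤ α⁻¹ / 2 * ⟪x, x - mix W x⟫_ℝ := by positivity
  linarith

lemma le_maxLip (L : Fin m → ℝ≥0) (i : Fin m) : (L i : ℝ) ≤ maxLip L :=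
  NNReal.coe_le_coe.2 (Finset.le_sup (Finset.mem_univ i))

lemma maxLip_nonneg (L : Fin m → ℝ≥0) : 0 ≤ maxLip L := NNReal.coe_nonneg _

section Objectives

variable {Lg LH : Fin m → ℝ≥0}

lemma Objectives.abs_inner_hess_le (hf : Objectives f Lg LH) (x v : Stack m n) :
    |⟪v, hess (stacked f) x v⟫_ℝ| ≤ maxLip Lg * ‖v‖ ^ 2 := by
  rw [inner_hess_stacked hf.smooth, norm_sq_stack, Finset.mul_sum]
  refine (Finset.abs_sum_le_sum_abs _ _).trans (Finset.sum_le_sum fun i _ => ?_)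
  exact (inner_hess_le (hf.lipschitz_grad i) (x i) (v i)).trans
    (mul_le_mul_of_nonneg_right (le_maxLip Lg i) (sq_nonneg _))

/-- The Hessian of `F` is block diagonal, so the blockwise Lipschitz constants enter through their
maximum. -/
lemma Objectives.inner_hess_sub_le (hf : Objectives f Lg LH) (x z v : Stack m n) :
    ⟪v, hess (stacked f) x v⟫_ℝ - maxLip LH * ‖z - x‖ * ‖v‖ ^ 2
      ≤ ⟪v, hess (stacked f) z v⟫_ℝ := by
  rw [inner_hess_stacked hf.smooth, inner_hess_stacked hf.smooth, norm_sq_stack v,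
    Finset.mul_sum, ← Finset.sum_sub_distrib]
  refine Finset.sum_le_sum fun i _ => ?_
  have h1 : ‖hess (f i) (x i) - hess (f i) (z i)‖ ≤ maxLip LH * ‖z - x‖ := by
    have h2 := (hf.lipschitz_hess i).dist_le_mul (x i) (z i)
    rw [dist_eq_norm, dist_eq_norm, norm_sub_rev (x i)] at h2
    refine h2.trans (mul_le_mul (le_maxLip LH i) ?_ (norm_nonneg _) (maxLip_nonneg LH))
    simpa using norm_block_le (z - x) i
  have h3 : ⟪v i, hess (f i) (x i) (v i)⟫_ℝ - ⟪v i, hess (f i) (z i) (v i)⟫_ℝ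
      = ⟪v i, (hess (f i) (x i) - hess (f i) (z i)) (v i)⟫_ℝ := by
    rw [sub_apply, inner_sub_right]
  have h4 := real_inner_le_norm (v i) ((hess (f i) (x i) - hess (f i) (z i)) (v i))
  have h5 := (hess (f i) (x i) - hess (f i) (z i)).le_of_opNorm_le h1 (v i)
  nlinarith [norm_nonneg (v i)]

lemma Objectives.exists_lower_bound (hf : Objectives f Lg LH) (i : Fin m) :
    ∃ c, ∀ x, c ≤ f i x := by
  obtain ⟨x, hx, hmin⟩ := (hf.coercive i (f i 0)).exists_isMinOn ⟨0, le_refl (f i 0)⟩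
    (hf.smooth i).continuous.continuousOn
  refine ⟨f i x, fun y => ?_⟩
  by_cases hy : f i y ≤ f i 0
  · exact hmin hy
  · exact le_trans hx (not_le.1 hy).le

lemma Objectives.exists_stacked_lower_bound (hf : Objectives f Lg LH) :
    ∃ c, ∀ x, c ≤ stacked f x := by
  choose c hc using hf.exists_lower_bound
  exact ⟨∑ i, c i, fun x => Finset.sum_le_sum fun i _ => hc i (x i)⟩

lemma Objectives.exists_norm_le (hf : Objectives f Lg LH) (b : ℝ) :
    ∃ R, 0 ≤ R ∧ ∀ x : Stack m n, stacked f x ≤ b → ‖x‖ ≤ R := by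
  choose c hc using hf.exists_lower_bound
  -- A bound on the sum bounds each summand, the others being bounded below; the compact sublevel
  -- set of each `f i` then confines its block.
  have hR : ∀ i, ∃ R : ℝ, ∀ y, f i y ≤ b - ∑ j ∈ Finset.univ.erase i, c j → ‖y‖ ≤ R := fun i =>
    (hf.coercive i (b - ∑ j ∈ Finset.univ.erase i, c j)).isBounded.exists_norm_le
  choose R hR using hR
  refine ⟨√(∑ i, R i ^ 2), Real.sqrt_nonneg _, fun x hx => ?_⟩
  refine Real.le_sqrt_of_sq_le ?_
  rw [norm_sq_stack]
  refine Finset.sum_le_sum fun i _ => pow_le_pow_left₀ (norm_nonneg _) (hR i _ ?_) 2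
  have h1 : stacked f x = f i (x i) + ∑ j ∈ Finset.univ.erase i, f j (x j) :=
    (Finset.add_sum_erase _ _ (Finset.mem_univ i)).symm
  have h2 : ∑ j ∈ Finset.univ.erase i, c j ≤ ∑ j ∈ Finset.univ.erase i, f j (x j) :=
    Finset.sum_le_sum fun j _ => hc j (x j)
  linarith

end Objectives

end Aux

/-! ### What the covering condition says about `Q_α`. -/

section Covering

variable {m n : ℕ} {f : Fin m → Vec n → ℝ} {W : Matrix (Fin m) (Fin m) ℝ}
  {Lg LH : Fin m → ℝ≥0} {α ε γ μ δ : ℝ} {G : SimpleGraph (Fin m)}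

lemma nontrivial_stack (hn : 0 < n) (hm : 0 < m) : Nontrivial (Stack m n) := by
  refine ⟨WithLp.toLp 2 fun _ => WithLp.toLp 2 fun _ => 1, 0, fun h => ?_⟩
  have := congrArg (fun x : Stack m n => x ⟨0, hm⟩ ⟨0, hn⟩) h
  simp at this

/-- A small gradient excludes the first region, and `λ_min(∇²F) ≥ -L ≥ -α⁻¹ > -γ - α⁻¹` excludes the
second, so only the strongly convex region is left. -/
lemma Covering.mu_le_lamMinHess [Nontrivial (Stack m n)]
    (hc : Covering f W (maxLip Lg) α ε γ μ δ)
    (hf : Objectives f Lg LH) (hα : maxLip Lg ≤ α⁻¹) {x : Stack m n}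
    (hx : ‖field f W α x‖ < ε) : μ ≤ lamMinHess (stacked f) x := by
  have hmem : x ∈ regionOne f W α ε ∪ regionTwo f α γ ∪ regionThree f W α μ δ := by
    rw [hc.cover]; trivial
  rcases hmem with (h | h) | h
  · exact absurd h (not_le.2 hx)
  · have h1 : -maxLip Lg ≤ lamMinHess (stacked f) x :=
      le_lamMin (hess_isSymmetric (contDiff_stacked hf.smooth) x) fun v => by
        have := (abs_le.1 (hf.abs_inner_hess_le x v)).1
        rw [neg_mul]
        exact this
    have h2 : lamMinHess (stacked f) x ≤ -γ - α⁻¹ := h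
    linarith [hc.gamma_mem.1]
  · exact h.1

lemma Covering.mu_mul_le [Nontrivial (Stack m n)] (hc : Covering f W (maxLip Lg) α ε γ μ δ)
    (hf : Objectives f Lg LH) (hα : maxLip Lg ≤ α⁻¹) {x : Stack m n}
    (hx : ‖field f W α x‖ < ε) (v : Stack m n) :
    μ * ‖v‖ ^ 2 ≤ ⟪v, hess (stacked f) x v⟫_ℝ :=
  (mul_le_mul_of_nonneg_right (hc.mu_le_lamMinHess hf hα hx) (sq_nonneg _)).trans
    (lamMin_mul_norm_sq_le (hess_isSymmetric (contDiff_stacked hf.smooth) x) v)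

/-- The radius on which a curvature bound `μ` of a function whose Hessian is `L`-Lipschitz
degrades at most by a factor `2`. -/
def curvRadius (L μ : ℝ) : ℝ := μ / (2 * (L + 1))

/-- The step `s` is kept separate from `α` because three values are needed: a tiny one for
uniqueness, `α` for the dynamics, and a longer one for the sharp descent inequality. The consensus
term only adds curvature. -/
lemma Covering.landscape [Nontrivial (Stack m n)] (hc : Covering f W (maxLip Lg) α ε γ μ δ)
    (hf : Objectives f Lg LH) (hW : Mixing G W) (hα0 : 0 < α) (hα : maxLip Lg ≤ α⁻¹) {s : ℝ}
    (hs : 0 < s) (hs1 : s * (maxLip Lg + α⁻¹ * (1 - lamMinMat W)) ≤ 1)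
    (hsμ : s * (μ / 2) ≤ 1) :
    Landscape (aux f W α) (field f W α) (hess (aux f W α)) s ε (μ / 2)
      (curvRadius (maxLip LH) μ) where
  grad x := by
    rw [← gradient_aux hf.smooth hW.symm]
    exact hasGradientAt_of_contDiff (contDiff_aux hf.smooth) x
  deriv x := by
    rw [← gradient_aux hf.smooth hW.symm]
    exact hasFDerivAt_gradient (contDiff_aux hf.smooth) x
  symm x u v := hess_symm (contDiff_aux hf.smooth) x u v
  step_pos := hs
  smooth x v := by
    rw [inner_hess_aux hf.smooth hW.symm]
    have h1 := (abs_le.1 (hf.abs_inner_hess_le x v)).2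
    have h2 : ⟪v, v - mix W v⟫_ℝ ≤ (1 - lamMinMat W) * ‖v‖ ^ 2 := by
      have := lamMinMat_mul_le hW.symm v
      rw [inner_sub_right, real_inner_self_eq_norm_sq]
      linarith
    have h3 := mul_le_mul_of_nonneg_left h2 (inv_pos.2 hα0).le
    calc s * (⟪v, hess (stacked f) x v⟫_ℝ + α⁻¹ * ⟪v, v - mix W v⟫_ℝ)
        ≤ s * ((maxLip Lg + α⁻¹ * (1 - lamMinMat W)) * ‖v‖ ^ 2) :=
          mul_le_mul_of_nonneg_left (by linarith) hs.le
      _ = (s * (maxLip Lg + α⁻¹ * (1 - lamMinMat W))) * ‖v‖ ^ 2 := by ring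
      _ ≤ ‖v‖ ^ 2 := mul_le_of_le_one_left (sq_nonneg _) hs1
  eps_pos := hc.eps_pos
  mu_pos := half_pos hc.mu_mem.1
  rho_pos := div_pos hc.mu_mem.1 (by linarith [maxLip_nonneg LH])
  step_mul_mu := hsμ
  convex x hx z hz v := by
    rw [inner_hess_aux hf.smooth hW.symm]
    have h1 := hc.mu_mul_le hf hα hx v
    have h2 := hf.inner_hess_sub_le x z v
    have h3 : 0 ≤ α⁻¹ * ⟪v, v - mix W v⟫_ℝ :=
      mul_nonneg (inv_pos.2 hα0).le (inner_sub_mix_nonneg hW.stochastic v)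
    have h4 : maxLip LH * ‖z - x‖ ≤ μ / 2 := by
      have hL := maxLip_nonneg LH
      have h5 : (maxLip LH + 1) * curvRadius (maxLip LH) μ = μ / 2 := by
        rw [curvRadius]; field_simp
      nlinarith [norm_nonneg (z - x)]
    have h5 := mul_le_mul_of_nonneg_right h4 (sq_nonneg ‖v‖)
    linarith

lemma Covering.localMinimizers_aux [Nontrivial (Stack m n)]
    (hc : Covering f W (maxLip Lg) α ε γ μ δ)
    (hf : Objectives f Lg LH) (hW : Mixing G W) (hα0 : 0 < α) (hα : maxLip Lg ≤ α⁻¹) :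
    localMinimizers (aux f W α) = {x | field f W α x = 0} := by
  ext x
  simp only [localMinimizers, gradient_aux hf.smooth hW.symm, Set.mem_ofPred_eq,
    and_iff_left_iff_imp]
  intro hx v hv
  rw [inner_hess_aux hf.smooth hW.symm]
  have h1 := hc.mu_mul_le hf hα (x := x) (by rw [hx, norm_zero]; exact hc.eps_pos) v
  have h2 : 0 < μ * ‖v‖ ^ 2 := mul_pos hc.mu_mem.1 (pow_pos (norm_pos_iff.2 hv) 2)
  have h3 : 0 ≤ α⁻¹ * ⟪v, v - mix W v⟫_ℝ :=
    mul_nonneg (inv_pos.2 hα0).le (inner_sub_mix_nonneg hW.stochastic v)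
  linarith

/-- Global minimality follows from uniqueness: descent from any `x` ends, without increasing the
value, at a critical point, which can only be `p`. -/
theorem Covering.exists_unique_minimizer [Nontrivial (Stack m n)]
    (hc : Covering f W (maxLip Lg) α ε γ μ δ)
    (hf : Objectives f Lg LH) (hW : Mixing G W) (hα0 : 0 < α) (hα : maxLip Lg ≤ α⁻¹) :
    ∃ p, field f W α p = 0 ∧ localMinimizers (aux f W α) = {p} ∧
      ∀ x, aux f W α p ≤ aux f W α x := by
  have hε := hc.eps_pos
  have hμ := hc.mu_mem.1
  set ρ := curvRadius (maxLip LH) μ with hρ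
  have hρ0 : 0 < ρ := div_pos hμ (by linarith [maxLip_nonneg LH])
  set A := maxLip Lg + α⁻¹ * (1 - lamMinMat W)
  -- A fictitious step unrelated to `α`, small enough for smoothness, contraction and `s ε ≤ ρ` at
  -- once.
  set s := min (1 / (|A| + 1)) (min (1 / (μ / 2)) (ρ / ε)) with hs
  have hs0 : 0 < s := by positivity
  have h1 : s * A ≤ 1 := by
    have : s ≤ 1 / (|A| + 1) := min_le_left _ _
    rw [le_div_iff₀ (by positivity)] at this
    nlinarith [le_abs_self A]
  have h2 : s * (μ / 2) ≤ 1 := by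
    have : s ≤ 1 / (μ / 2) := (min_le_right _ _).trans (min_le_left _ _)
    rwa [le_div_iff₀ (by positivity)] at this
  have h3 : s * ε ≤ ρ := by
    have : s ≤ ρ / ε := (min_le_right _ _).trans (min_le_right _ _)
    rwa [le_div_iff₀ (by positivity)] at this
  have hL := hc.landscape hf hW hα0 hα hs0 h1 h2
  obtain ⟨c, hcb⟩ := hf.exists_stacked_lower_bound
  have hcb' : ∀ x, c ≤ aux f W α x := fun x =>
    (hcb x).trans (stacked_le_aux hW.stochastic hα0 x)
  obtain ⟨p, hp, -⟩ := hL.exists_crit_val_le h3 hcb' 0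
  refine ⟨p, hp, ?_, fun x => ?_⟩
  · rw [hc.localMinimizers_aux hf hW hα0 hα]
    ext y
    simp only [Set.mem_ofPred_eq, Set.mem_singleton_iff]
    exact ⟨fun hy => hL.crit_unique h3 hcb' hy hp, fun hy => hy ▸ hp⟩
  · obtain ⟨q, hq, hle⟩ := hL.exists_crit_val_le h3 hcb' x
    rwa [hL.crit_unique h3 hcb' hp hq]

end Covering

/-! ### Existence of a threshold by compactness. -/

section Threshold

variable {m n : ℕ} {f : Fin m → Vec n → ℝ} {W : Matrix (Fin m) (Fin m) ℝ}
  {Lg LH : Fin m → ℝ≥0} {α ε γ μ δ : ℝ} {G : SimpleGraph (Fin m)}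

/-- The Dirichlet form vanishes, so the blocks agree across every edge, and along walks by
connectedness. -/
lemma Mixing.eq_of_mix_eq (hW : Mixing G W) (hG : G.Connected) {z : Stack m n}
    (hz : z - mix W z = 0) (i j : Fin m) : z i = z j := by
  have h0 := inner_sub_mix hW.stochastic z
  rw [hz, inner_zero_right] at h0
  have hnn := (mem_doublyStochastic_iff_sum.1 hW.stochastic).1
  have hterm : ∀ i j, 0 ≤ W i j * ‖z i - z j‖ ^ 2 := fun i j =>
    mul_nonneg (hnn i j) (sq_nonneg _)
  have h1 : ∑ i, ∑ j, W i j * ‖z i - z j‖ ^ 2 = 0 := by linarith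
  have h2 : ∀ i j, W i j * ‖z i - z j‖ ^ 2 = 0 := fun i j => by
    have h3 := (Finset.sum_eq_zero_iff_of_nonneg fun i _ =>
      Finset.sum_nonneg fun j _ => hterm i j).1 h1 i (Finset.mem_univ i)
    exact (Finset.sum_eq_zero_iff_of_nonneg fun j _ => hterm i j).1 h3 j (Finset.mem_univ j)
  have hadj : ∀ i j, G.Adj i j → z i = z j := fun i j hij => by
    have h3 := (mul_eq_zero.1 (h2 i j)).resolve_left (hW.adj_pos i j hij).ne'
    exact sub_eq_zero.1 (norm_eq_zero.1 (pow_eq_zero_iff two_ne_zero |>.1 h3))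
  obtain ⟨w⟩ := hG.preconnected i j
  induction w with
  | nil => rfl
  | cons h _ ih => exact (hadj _ _ h).trans ih

lemma sum_sub_mix (hW : W ∈ doublyStochastic ℝ (Fin m)) (x : Stack m n) :
    ∑ i, (x - mix W x) i = 0 := by
  have hcol := (mem_doublyStochastic_iff_sum.1 hW).2.2
  simp only [PiLp.sub_apply, mix_apply, Finset.sum_sub_distrib]
  rw [Finset.sum_comm]
  simp [← Finset.sum_smul, hcol]

lemma sum_gradient_eq_zero (hf : ∀ i, ContDiff ℝ 2 (f i))
    (hW : W ∈ doublyStochastic ℝ (Fin m)) {x : Stack m n} (hx : field f W α x = 0) :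
    ∑ i, gradient (f i) (x i) = 0 := by
  have h1 : ∀ i, gradient (f i) (x i) + α⁻¹ • (x - mix W x) i = 0 := fun i => by
    have := congrArg (fun y : Stack m n => y i) hx
    simpa only [field, gradient_stacked hf, PiLp.add_apply, PiLp.smul_apply,
      PiLp.zero_apply] using this
  have h2 := Finset.sum_congr rfl fun i (_ : i ∈ Finset.univ) => h1 i
  rw [Finset.sum_add_distrib, ← Finset.smul_sum, sum_sub_mix hW, smul_zero, add_zero] at h2
  simpa using h2

lemma sub_mix_eq (hα : 0 < α) {x : Stack m n} (hx : field f W α x = 0) :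
    x - mix W x = -(α • gradient (stacked f) x) := by
  have h1 : α⁻¹ • (x - mix W x) = -gradient (stacked f) x :=
    eq_neg_of_add_eq_zero_right hx
  have h2 : α • (α⁻¹ • (x - mix W x)) = x - mix W x := smul_inv_smul₀ hα.ne' _
  rw [← h2, h1, smul_neg]

lemma close_of_norm_sub_le {V : Type*} [NormedAddCommGroup V] [InnerProductSpace ℝ V]
    [CompleteSpace V] {r : ℝ} {x y : V} {Y : Set V}
    (hy : y ∈ Y) (h : ‖x - y‖ ≤ r) : Close r x Y := by
  refine (Metric.infEDist_le_edist_of_mem hy).trans ?_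
  rw [edist_dist, dist_eq_norm]
  exact ENNReal.ofReal_le_ofReal h

lemma nontrivial_vec (hn : 0 < n) : Nontrivial (Vec n) := by
  refine ⟨WithLp.toLp 2 fun _ => 1, 0, fun h => ?_⟩
  have := congrArg (fun x : Vec n => x ⟨0, hn⟩) h
  simp at this

/-- Limits only give a semidefinite Hessian; the assumption that `λ_min` is nonzero at critical
points upgrades it to definite. -/
lemma mem_localMinimizers_of_nonneg (hn : 0 < n) (hf : Objectives f Lg LH) {x : Vec n}
    (hx : gradient (total f) x = 0) (h : ∀ v, 0 ≤ ⟪v, hess (total f) x v⟫_ℝ) :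
    x ∈ localMinimizers (total f) := by
  have := nontrivial_vec hn
  have hsymm := hess_isSymmetric (contDiff_total hf.smooth) x
  have h1 : 0 ≤ lamMinHess (total f) x := le_lamMin hsymm fun v => by simpa using h v
  have h2 : 0 < lamMinHess (total f) x :=
    (hf.strict_saddle x hx).resolve_right (not_lt.2 h1)
  exact ⟨hx, fun v hv => lt_of_lt_of_le (mul_pos h2 (pow_pos (norm_pos_iff.2 hv) 2))
    (lamMin_mul_norm_sq_le hsymm v)⟩

theorem exists_isThreshold (hn : 0 < n) (hG : G.Connected) (hW : Mixing G W)
    (hf : Objectives f Lg LH) {Δ : ℝ} (hΔ : 0 < Δ) :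
    ∃ a, IsThreshold f W (maxLip Lg) Δ a := by
  by_contra! hcon
  have hm : 0 < m := Fin.pos_iff_nonempty.2 hG.nonempty
  have := nontrivial_stack (m := m) hn hm
  have hL := maxLip_nonneg Lg
  have hseq : ∀ k : ℕ, ∃ (α : ℝ) (x : Stack m n) (i : Fin m),
      (0 < α ∧ α ≤ 1 / ((k : ℝ) + 1)) ∧ field f W α x = 0 ∧
      (∀ v, 0 ≤ ⟪v, hess (stacked f) x v⟫_ℝ) ∧ stacked f x ≤ stacked f 0 ∧
      ¬ Close Δ (x i) (localMinimizers (total f)) := fun k => by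
    -- This choice forces both `L ≤ α⁻¹` and `α → 0`.
    have h1 := hcon (1 / (maxLip Lg + k + 1))
    have h2 : 0 < 1 / (maxLip Lg + k + 1) := by positivity
    simp only [IsThreshold, h2, true_and, not_forall] at h1
    obtain ⟨α, ⟨hα0, hα1⟩, ⟨ε, γ, μ, δ, hc⟩, x, hx, i, hi⟩ := h1
    have hα2 : maxLip Lg + k + 1 ≤ α⁻¹ := by
      rw [one_div] at hα1
      exact (le_inv_comm₀ (by positivity) hα0).2 hα1
    have hα3 : maxLip Lg ≤ α⁻¹ := by
      have : (0 : ℝ) ≤ k := k.cast_nonneg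
      linarith
    obtain ⟨p, hp, hloc, hmin⟩ := hc.exists_unique_minimizer hf hW hα0 hα3
    rw [hloc, Set.mem_singleton_iff] at hx
    subst hx
    refine ⟨α, x, i, ⟨hα0, hα1.trans ?_⟩, hp, fun v => ?_, ?_, hi⟩
    · gcongr
      linarith
    · exact (mul_nonneg hc.mu_mem.1.le (sq_nonneg _)).trans (hc.mu_mul_le hf hα3
        (by rw [hp, norm_zero]; exact hc.eps_pos) v)
    -- Comparison with `0`, where the consensus penalty vanishes, gives a bound independent of `α`.
    · refine (stacked_le_aux hW.stochastic hα0 x).trans ((hmin 0).trans (le_of_eq ?_))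
      rw [aux_eq, inner_zero_left, mul_zero, add_zero]
  choose α x i hα hx hpos hle hclose using hseq
  obtain ⟨R, -, hR⟩ := hf.exists_norm_le (stacked f 0)
  obtain ⟨z, -, φ, hφ, hz⟩ := (isCompact_closedBall (0 : Stack m n) R).tendsto_subseq
    (x := x) fun k => by
      rw [mem_closedBall, dist_zero_right]
      exact hR _ (hle k)
  have hαlim : Tendsto (fun k => α (φ k)) atTop (𝓝 0) := by
    have h1 : Tendsto α atTop (𝓝 0) :=
      squeeze_zero (fun k => (hα k).1.le) (fun k => (hα k).2)
        tendsto_one_div_add_atTop_nhds_zero_nat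
    exact h1.comp hφ.tendsto_atTop
  have hcg : Continuous (gradient (stacked f)) :=
    (contDiff_gradient (contDiff_stacked hf.smooth)).continuous
  have hzfix : z - mix W z = 0 := by
    have h1 : Tendsto (fun k => x (φ k) - mix W (x (φ k))) atTop (𝓝 (z - mix W z)) :=
      ((continuous_id.sub (continuous_mix W)).tendsto z).comp hz
    have h2 : Tendsto (fun k => -(α (φ k) • gradient (stacked f) (x (φ k)))) atTop
        (𝓝 (-((0 : ℝ) • gradient (stacked f) z))) :=
      (hαlim.smul ((hcg.tendsto z).comp hz)).neg
    rw [zero_smul, neg_zero] at h2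
    refine tendsto_nhds_unique h1 (h2.congr fun k => ?_)
    rw [sub_mix_eq (hα _).1 (hx _)]
  set w : Vec n := z ⟨0, hm⟩ with hw
  have hzw : ∀ j, z j = w := fun j => hW.eq_of_mix_eq hG hzfix j _
  have hblock : ∀ j, Tendsto (fun k => x (φ k) j) atTop (𝓝 w) := fun j => by
    rw [← hzw j]
    exact ((contDiff_block (k := 0) j).continuous.tendsto z).comp hz
  have hgrad : gradient (total f) w = 0 := by
    rw [gradient_total hf.smooth]
    have h1 : Tendsto (fun k => ∑ j, gradient (f j) (x (φ k) j)) atTop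
        (𝓝 (∑ j, gradient (f j) w)) := tendsto_finsetSum _ fun j _ =>
      ((contDiff_gradient (hf.smooth j)).continuous.tendsto w).comp (hblock j)
    refine tendsto_nhds_unique h1 (tendsto_const_nhds.congr fun k => ?_)
    rw [sum_gradient_eq_zero hf.smooth hW.stochastic (hx (φ k))]
  -- The Hessian of `F` is tested on the constant stack `(v, …, v)`, where it becomes the sum of the
  -- local Hessians.
  have hhess : ∀ v, 0 ≤ ⟪v, hess (total f) w v⟫_ℝ := fun v => by
    have h1 : ∀ y : Stack m n, ⟪(WithLp.toLp 2 fun _ => v : Stack m n),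
        hess (stacked f) y (WithLp.toLp 2 fun _ => v : Stack m n)⟫_ℝ
        = ∑ j, ⟪v, hess (f j) (y j) v⟫_ℝ := fun y => inner_hess_stacked hf.smooth _ _
    have h2 : Tendsto (fun k => ∑ j, ⟪v, hess (f j) (x (φ k) j) v⟫_ℝ) atTop
        (𝓝 (∑ j, ⟪v, hess (f j) w v⟫_ℝ)) := tendsto_finsetSum _ fun j _ =>
      ((continuous_const.inner ((continuous_hess (hf.smooth j)).clm_apply
        continuous_const)).tendsto w).comp (hblock j)
    rw [hess_total hf.smooth, sum_apply, inner_sum]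
    exact ge_of_tendsto h2 (Eventually.of_forall fun k => h1 _ ▸ hpos (φ k) _)
  have hwmem := mem_localMinimizers_of_nonneg hn hf hgrad hhess
  have hev : ∀ᶠ k in atTop, ∀ j, ‖x (φ k) j - w‖ < Δ := by
    refine eventually_all.2 fun j => ?_
    have h1 := (hblock j).eventually (ball_mem_nhds w hΔ)
    filter_upwards [h1] with k hk
    rwa [dist_eq_norm] at hk
  obtain ⟨k, hk⟩ := hev.exists
  exact hclose (φ k) (close_of_norm_sub_le hwmem (hk _).le)

end Threshold

/-! ### Adapted bounded noise. -/

section Noise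

variable {V : Type*} [NormedAddCommGroup V] [InnerProductSpace ℝ V] [MeasurableSpace V]
  [BorelSpace V] [SecondCountableTopology V] {Ω : Type*} [mΩ : MeasurableSpace Ω]

/-- Centred bounded noise `Ξ`, adapted to `F`, such that `Ξ k` is independent of the past `F k`. -/
structure NoiseSeq (P : Measure Ω) (F : ℕ → MeasurableSpace Ω) (Ξ : ℕ → Ω → V)
    (S B : ℝ) : Prop where
  le : ∀ k, F k ≤ mΩ
  mono : Monotone F
  meas : ∀ k, Measurable[F (k + 1)] (Ξ k)
  indep : ∀ k, Indep (F k) (MeasurableSpace.comap (Ξ k) inferInstance) P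
  mean : ∀ k u, ∫ ω, ⟪u, Ξ k ω⟫_ℝ ∂P = 0
  second_moment : ∀ k, ∫ ω, ‖Ξ k ω‖ ^ 2 ∂P ≤ S
  bdd : ∀ k, ∀ᵐ ω ∂P, ‖Ξ k ω‖ ≤ B

/-- The iterates `x ↦ φ(x) - α ξ`. -/
def noisyPath (φ : V → V) (α : ℝ) (x₀ : V) (ξ : ℕ → V) : ℕ → V
  | 0 => x₀
  | k + 1 => φ (noisyPath φ α x₀ ξ k) - α • ξ k

/-- The freezing lemma: `X` and `D` belong to the past and `Z` is independent of it, so by Tonelli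
`Z` may be integrated first with `X` fixed. It stands in for conditional expectations. -/
theorem lintegral_le_of_indep {E S : Type*} [MeasurableSpace E] [MeasurableSpace S]
    {P : Measure Ω} [IsProbabilityMeasure P]
    {ι : Type*} {F : ι → MeasurableSpace Ω} {i : ι}
    (hF : F i ≤ mΩ) {X : Ω → S} (hX : Measurable[F i] X) {Z : Ω → E}
    (hZ : Measurable Z) (hind : Indep (F i) (MeasurableSpace.comap Z inferInstance) P) {D : Set Ω}
    (hD : MeasurableSet[F i] D) {h : S → E → ℝ≥0∞} (hh : Measurable (Function.uncurry h))
    {u : Ω → ℝ≥0∞} (hu : ∀ᵐ ω ∂P, ω ∈ D → ∫⁻ ω', h (X ω) (Z ω') ∂P ≤ u ω) :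
    ∫⁻ ω in D, h (X ω) (Z ω) ∂P ≤ ∫⁻ ω in D, u ω ∂P := by
  -- The event `D` is carried along as an indicator, so that one product law handles both.
  set Y : Ω → S × ℝ≥0∞ := fun ω => (X ω, D.indicator 1 ω) with hYdef
  have hY : Measurable[F i] Y := hX.prodMk (Measurable.indicator (@measurable_const _ _ _ (F i) 1) hD)
  have hY' : Measurable Y := hY.mono hF le_rfl
  have hYZ : IndepFun Y Z P := indep_of_indep_of_le_left hind hY.comap_le
  have hmap := (indepFun_iff_map_prod_eq_prod_map_map hY'.aemeasurable hZ.aemeasurable).1 hYZ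
  set k : (S × ℝ≥0∞) × E → ℝ≥0∞ := fun p => p.1.2 * h p.1.1 p.2 with hkdef
  have hk : Measurable k := by
    refine (measurable_snd.comp measurable_fst).mul (hh.comp
      ((measurable_fst.comp measurable_fst).prodMk measurable_snd))
  have hD' := hF _ hD
  have h1 : ∫⁻ ω in D, h (X ω) (Z ω) ∂P = ∫⁻ ω, k (Y ω, Z ω) ∂P := by
    rw [← lintegral_indicator hD']
    refine lintegral_congr fun ω => ?_
    by_cases hω : ω ∈ D <;> simp [hkdef, hYdef, hω]
  have h2 : ∫⁻ ω, k (Y ω, Z ω) ∂P = ∫⁻ ω, ∫⁻ ω', k (Y ω, Z ω') ∂P ∂P := by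
    rw [← lintegral_map (g := fun ω => (Y ω, Z ω)) hk (hY'.prodMk hZ), hmap,
      lintegral_prod _ hk.aemeasurable, lintegral_map hk.lintegral_prod_right' hY']
    refine lintegral_congr fun ω => ?_
    exact lintegral_map (hk.comp measurable_prodMk_left) hZ
  rw [h1, h2, ← lintegral_indicator hD']
  refine lintegral_mono_ae (hu.mono fun ω hω => ?_)
  by_cases hωD : ω ∈ D
  · simpa [hkdef, hYdef, hωD] using hω hωD
  · simp [hkdef, hYdef, hωD]

namespace NoiseSeq

variable {P : Measure Ω} [IsProbabilityMeasure P] {F : ℕ → MeasurableSpace Ω} {Ξ : ℕ → Ω → V}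
  {S B : ℝ}

omit [IsProbabilityMeasure P] [SecondCountableTopology V] [BorelSpace V] in
lemma measurable (hN : NoiseSeq P F Ξ S B) (k : ℕ) : Measurable (Ξ k) :=
  (hN.meas k).mono (hN.le _) le_rfl

omit [IsProbabilityMeasure P] in
lemma measurable_path (hN : NoiseSeq P F Ξ S B) {φ : V → V} (hφ : Continuous φ) (α : ℝ)
    (x₀ : V) (k : ℕ) : Measurable[F k] fun ω => noisyPath φ α x₀ (fun j => Ξ j ω) k := by
  induction k with
  | zero => exact measurable_const
  | succ k ih =>
    exact (hφ.measurable.comp (ih.mono (hN.mono k.le_succ) le_rfl)).sub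
      ((hN.meas k).const_smul α)

lemma integrable_inner (hN : NoiseSeq P F Ξ S B) (k : ℕ) (u : V) :
    Integrable (fun ω => ⟪u, Ξ k ω⟫_ℝ) P := by
  refine Integrable.of_bound ((hN.measurable k).const_inner).aestronglyMeasurable (‖u‖ * B) ?_
  filter_upwards [hN.bdd k] with ω hω
  exact (norm_inner_le_norm _ _).trans (mul_le_mul_of_nonneg_left hω (norm_nonneg _))

omit [SecondCountableTopology V] in
lemma integrable_norm_sq (hN : NoiseSeq P F Ξ S B) (k : ℕ) :
    Integrable (fun ω => ‖Ξ k ω‖ ^ 2) P := by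
  refine Integrable.of_bound ((hN.measurable k).norm.pow_const 2).aestronglyMeasurable
    (B ^ 2) ?_
  filter_upwards [hN.bdd k] with ω hω
  rw [Real.norm_of_nonneg (by positivity)]
  exact pow_le_pow_left₀ (norm_nonneg _) hω 2

lemma lintegral_exp_inner_le (hN : NoiseSeq P F Ξ S B) (hB : 0 ≤ B) (k : ℕ) (u : V) (t : ℝ) :
    ∫⁻ ω, ENNReal.ofReal (Real.exp (t * ⟪u, Ξ k ω⟫_ℝ)) ∂P
      ≤ ENNReal.ofReal (Real.exp ((‖u‖ * B) ^ 2 * t ^ 2 / 2)) := by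
  have h1 := hasSubgaussianMGF_of_mem_Icc_of_integral_eq_zero (μ := P)
    (X := fun ω => ⟪u, Ξ k ω⟫_ℝ) (a := -(‖u‖ * B)) (b := ‖u‖ * B)
    ((hN.measurable k).const_inner).aemeasurable (by
      filter_upwards [hN.bdd k] with ω hω
      exact abs_le.1 ((abs_real_inner_le_norm _ _).trans
        (mul_le_mul_of_nonneg_left hω (norm_nonneg _)))) (hN.mean k u)
  rw [← ofReal_integral_eq_lintegral_ofReal (h1.integrable_exp_mul t)
    (Eventually.of_forall fun _ => (Real.exp_pos _).le)]
  refine ENNReal.ofReal_le_ofReal ((h1.mgf_le t).trans (le_of_eq ?_))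
  have h2 : (‖‖u‖ * B - -(‖u‖ * B)‖₊ : ℝ) = 2 * (‖u‖ * B) := by
    rw [coe_nnnorm, Real.norm_of_nonneg] <;> nlinarith [mul_nonneg (norm_nonneg u) hB]
  congr 3
  push_cast
  rw [← coe_nnnorm, h2]
  ring

/-- Expand the square: the noise term is bounded by `B²`, and Hoeffding's lemma for the cross term
yields `2 θ² α² B² ‖u‖²`. -/
lemma lintegral_exp_le (hN : NoiseSeq P F Ξ S B) (hB : 0 ≤ B) (k : ℕ) (u : V) {θ : ℝ}
    (hθ : 0 ≤ θ) (α : ℝ) :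
    ∫⁻ ω, ENNReal.ofReal (Real.exp (θ * ‖u - α • Ξ k ω‖ ^ 2)) ∂P ≤ ENNReal.ofReal (Real.exp
      (θ * ‖u‖ ^ 2 * (1 + 2 * θ * α ^ 2 * B ^ 2) + θ * α ^ 2 * B ^ 2)) := by
  calc ∫⁻ ω, ENNReal.ofReal (Real.exp (θ * ‖u - α • Ξ k ω‖ ^ 2)) ∂P
      ≤ ∫⁻ ω, ENNReal.ofReal (Real.exp (θ * ‖u‖ ^ 2 + θ * α ^ 2 * B ^ 2)) *
          ENNReal.ofReal (Real.exp (-(2 * θ * α) * ⟪u, Ξ k ω⟫_ℝ)) ∂P := by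
        refine lintegral_mono_ae ((hN.bdd k).mono fun ω hω => ?_)
        rw [← ENNReal.ofReal_mul (Real.exp_pos _).le, ← Real.exp_add]
        refine ENNReal.ofReal_le_ofReal (Real.exp_le_exp.2 ?_)
        rw [norm_sub_sq_real, inner_smul_right, norm_smul, mul_pow, Real.norm_eq_abs, sq_abs]
        have h1 : ‖Ξ k ω‖ ^ 2 ≤ B ^ 2 := pow_le_pow_left₀ (norm_nonneg _) hω 2
        have h2 := mul_le_mul_of_nonneg_left h1 (mul_nonneg hθ (sq_nonneg α))
        linarith
    _ = ENNReal.ofReal (Real.exp (θ * ‖u‖ ^ 2 + θ * α ^ 2 * B ^ 2)) *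
          ∫⁻ ω, ENNReal.ofReal (Real.exp (-(2 * θ * α) * ⟪u, Ξ k ω⟫_ℝ)) ∂P := by
        rw [lintegral_const_mul' _ _ ENNReal.ofReal_ne_top]
    _ ≤ _ := by
        refine (mul_le_mul_right (hN.lintegral_exp_inner_le hB k u _) _).trans (le_of_eq ?_)
        rw [← ENNReal.ofReal_mul (Real.exp_pos _).le, ← Real.exp_add]
        congr 2
        ring

end NoiseSeq

/-! ### Hitting the region of small gradient. -/

section Hitting

variable {P : Measure Ω} [IsProbabilityMeasure P] {F : ℕ → MeasurableSpace Ω} {Ξ : ℕ → Ω → V}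
  {S B : ℝ} {Q : V → ℝ} {g : V → V} {α κ η ε M : ℝ}

lemma NoiseSeq.lintegral_val_le (hN : NoiseSeq P F Ξ S B)
    (hα : 0 < α) (hκ0 : 0 ≤ κ) (hκ : κ ≤ 2)
    (hdesc : ∀ x v, Q (x + v) ≤ Q x + ⟪g x, v⟫_ℝ + κ / (2 * α) * ‖v‖ ^ 2)
    (hε : 0 ≤ ε) (hη : η * ε ^ 2 ≤ (1 - κ / 2) * ε ^ 2 - κ / 2 * S) (hQ1 : ∀ x, 1 ≤ Q x)
    {x : V} (hx : ε ≤ ‖g x‖) (k : ℕ) :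
    ∫⁻ ω, ENNReal.ofReal (Q (gradStep g α x - α • Ξ k ω)) ∂P
      ≤ ENNReal.ofReal (Q x - α * η * ε ^ 2) := by
  -- The right side of `hdesc` for the increment `-α (g x + Ξ k ω)`; its linear noise term has mean
  -- zero.
  set R : Ω → ℝ := fun ω => Q x - α * (1 - κ / 2) * ‖g x‖ ^ 2 - α * (1 - κ) * ⟪g x, Ξ k ω⟫_ℝ
    + κ * α / 2 * ‖Ξ k ω‖ ^ 2 with hR
  have h1 : ∀ ω, Q (gradStep g α x - α • Ξ k ω) ≤ R ω := fun ω => by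
    have h2 := hdesc x (-(α • (g x + Ξ k ω)))
    have h3 : gradStep g α x - α • Ξ k ω = x + -(α • (g x + Ξ k ω)) := by
      rw [gradStep, smul_add]; abel
    rw [h3]
    refine h2.trans (le_of_eq ?_)
    rw [norm_neg, norm_smul, Real.norm_of_nonneg hα.le, inner_neg_right, inner_smul_right,
      inner_add_right, real_inner_self_eq_norm_sq, mul_pow, norm_add_sq_real, hR]
    field_simp
    ring
  have hi1 : Integrable (fun ω => Q x - α * (1 - κ / 2) * ‖g x‖ ^ 2
      - α * (1 - κ) * ⟪g x, Ξ k ω⟫_ℝ) P :=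
    (integrable_const _).sub ((hN.integrable_inner k (g x)).const_mul _)
  have hi2 : Integrable (fun ω => κ * α / 2 * ‖Ξ k ω‖ ^ 2) P :=
    (hN.integrable_norm_sq k).const_mul _
  have h4 : ∫ ω, R ω ∂P ≤ Q x - α * η * ε ^ 2 := by
    rw [hR, integral_add hi1 hi2, integral_sub (integrable_const _)
      ((hN.integrable_inner k (g x)).const_mul _), integral_const_mul, integral_const_mul,
      hN.mean k (g x)]
    simp only [integral_const, probReal_univ, one_smul, mul_zero, sub_zero]
    have h5 := mul_le_mul_of_nonneg_left (hN.second_moment k)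
      (by positivity : 0 ≤ κ * α / 2)
    have h6 : ε ^ 2 ≤ ‖g x‖ ^ 2 := pow_le_pow_left₀ hε hx 2
    have h7 := mul_le_mul_of_nonneg_left h6
      (mul_nonneg hα.le (by linarith : 0 ≤ 1 - κ / 2))
    have h8 := mul_le_mul_of_nonneg_left hη hα.le
    nlinarith
  calc ∫⁻ ω, ENNReal.ofReal (Q (gradStep g α x - α • Ξ k ω)) ∂P
      ≤ ∫⁻ ω, ENNReal.ofReal (R ω) ∂P :=
        lintegral_mono fun ω => ENNReal.ofReal_le_ofReal (h1 ω)
    _ = ENNReal.ofReal (∫ ω, R ω ∂P) := by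
        rw [ofReal_integral_eq_lintegral_ofReal (show Integrable R P from hi1.add hi2)]
        exact Eventually.of_forall fun ω => zero_le_one.trans ((hQ1 _).trans (h1 ω))
    _ ≤ _ := ENNReal.ofReal_le_ofReal h4

/-- A noisy gradient descent whose objective stays bounded reaches the set `‖g‖ < ε`, up to an
exponentially small probability. -/
theorem NoiseSeq.measure_forall_le_norm_grad (hN : NoiseSeq P F Ξ S B) (hQc : Continuous Q)
    (hgc : Continuous g) (hα : 0 < α) (hκ0 : 0 ≤ κ) (hκ : κ ≤ 2)
    (hdesc : ∀ x v, Q (x + v) ≤ Q x + ⟪g x, v⟫_ℝ + κ / (2 * α) * ‖v‖ ^ 2)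
    (hε : 0 ≤ ε) (hη0 : 0 ≤ η) (hη : η * ε ^ 2 ≤ (1 - κ / 2) * ε ^ 2 - κ / 2 * S)
    (hQ1 : ∀ x, 1 ≤ Q x) (hM0 : 0 < M) {x₀ : V}
    (hM : ∀ᵐ ω ∂P, ∀ k, Q (noisyPath (gradStep g α) α x₀ (fun j => Ξ j ω) k) ≤ M) (k : ℕ) :
    P {ω | ∀ j < k, ε ≤ ‖g (noisyPath (gradStep g α) α x₀ (fun j => Ξ j ω) j)‖}
      ≤ ENNReal.ofReal (M * Real.exp (-(α * η * ε ^ 2 / M) * k)) := by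
  set X : ℕ → Ω → V := fun k ω => noisyPath (gradStep g α) α x₀ (fun j => Ξ j ω) k with hX
  have hφc : Continuous (gradStep g α) := continuous_id.sub (hgc.const_smul α)
  have hXm : ∀ k, Measurable[F k] (X k) := hN.measurable_path hφc α x₀
  set N : ℕ → Set Ω := fun k => {ω | ∀ j < k, ε ≤ ‖g (X j ω)‖} with hNdef
  have hNmeas : ∀ k, MeasurableSet[F k] (N (k + 1)) := fun k => by
    have : N (k + 1) = ⋂ j ∈ Set.Iio (k + 1), X j ⁻¹' {x | ε ≤ ‖g x‖} := by
      ext ω; simp [hNdef]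
    rw [this]
    refine MeasurableSet.biInter (Set.to_countable _) fun j hj => ?_
    exact (hXm j).mono (hN.mono (Nat.lt_succ_iff.1 hj)) le_rfl
      (isClosed_le continuous_const hgc.norm).measurableSet
  set r := α * η * ε ^ 2 / M with hr
  have hJ : ∀ k : ℕ, ∫⁻ ω in N k, ENNReal.ofReal (Q (X k ω)) ∂P
      ≤ ENNReal.ofReal (M * Real.exp (-r * k)) := fun k => by
    induction k with
    | zero =>
      refine (setLIntegral_le_lintegral _ _).trans ?_
      refine (lintegral_mono_ae (g := fun _ => ENNReal.ofReal M)
        (hM.mono fun ω hω => ENNReal.ofReal_le_ofReal (hω 0))).trans ?_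
      simp
    | succ k ih =>
      have h1 : ∫⁻ ω in N (k + 1), ENNReal.ofReal (Q (X (k + 1) ω)) ∂P
          ≤ ∫⁻ ω in N (k + 1), ENNReal.ofReal (Real.exp (-r)) * ENNReal.ofReal (Q (X k ω)) ∂P := by
        refine lintegral_le_of_indep (hN.le k) (hXm k) (hN.measurable k)
          (hN.indep k) (hNmeas k)
          (h := fun x w => ENNReal.ofReal (Q (gradStep g α x - α • w))) ?_ ?_
        · exact (hQc.comp ((hφc.comp continuous_fst).sub
            (continuous_snd.const_smul α))).measurable.ennreal_ofReal
        · filter_upwards [hM] with ω hω hωN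
          refine (hN.lintegral_val_le hα hκ0 hκ hdesc hε hη hQ1 (hωN k k.lt_succ_self) k).trans ?_
          rw [← ENNReal.ofReal_mul (Real.exp_pos _).le]
          refine ENNReal.ofReal_le_ofReal ?_
          have h2 : Q (X k ω) ≤ M := hω k
          have h3 : 1 ≤ Q (X k ω) := hQ1 _
          have h4 := Real.add_one_le_exp (-r)
          -- Since `Q ≤ M`, the additive decrease is at least the fraction `r` of the current value,
          -- which makes the decay geometric.
          have h5 : r * Q (X k ω) ≤ α * η * ε ^ 2 := by
            calc r * Q (X k ω) ≤ r * M := mul_le_mul_of_nonneg_left h2 (by positivity)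
              _ = α * η * ε ^ 2 := by rw [hr]; field_simp
          nlinarith
      refine h1.trans ?_
      rw [lintegral_const_mul' _ _ ENNReal.ofReal_ne_top]
      have h2 : N (k + 1) ⊆ N k := fun ω hω j hj => hω j (hj.trans k.lt_succ_self)
      refine (mul_le_mul_right ((lintegral_mono_set h2).trans ih) _).trans (le_of_eq ?_)
      rw [← ENNReal.ofReal_mul (Real.exp_pos _).le]
      congr 1
      rw [mul_left_comm, ← Real.exp_add]
      push_cast
      ring_nf
  refine le_trans ?_ (hJ k)
  rw [← setLIntegral_one]
  refine lintegral_mono fun ω => ?_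
  rw [← ENNReal.ofReal_one]
  exact ENNReal.ofReal_le_ofReal (hQ1 _)

end Hitting

/-! ### Comparing the noisy path with the noiseless one. -/

section Coupling

variable [CompleteSpace V] {P : Measure Ω} [IsProbabilityMeasure P] {F : ℕ → MeasurableSpace Ω}
  {Ξ : ℕ → Ω → V} {S B : ℝ} {Q : V → ℝ} {g : V → V} {H : V → V →L[ℝ] V} {α ε μ ρ : ℝ}

/-- The difference, `j` steps after the time `t`, between the noisy iterates and the noiseless
iterates started from the noisy one at the time `t`. -/
def deviation (g : V → V) (α : ℝ) (x₀ : V) (ξ : ℕ → V) (t j : ℕ) : V :=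
  noisyPath (gradStep g α) α x₀ ξ (t + j) -
    (gradStep g α)^[j] (noisyPath (gradStep g α) α x₀ ξ t)

/-- While a noisy descent started with a small gradient follows the noiseless one, the
exponential moment of their squared distance is bounded. -/
theorem NoiseSeq.lintegral_exp_deviation_le (hN : NoiseSeq P F Ξ S B) (hB : 0 < B)
    (hL : Landscape Q g H α ε μ ρ) (hρ : α * ε ≤ ρ) (x₀ : V) (t j : ℕ) :
    ∫⁻ ω in {ω | ‖g (noisyPath (gradStep g α) α x₀ (fun j => Ξ j ω) t)‖ < ε ∧
        ∀ i ≤ j, ‖deviation g α x₀ (fun j => Ξ j ω) t i‖ ≤ ρ},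
      ENNReal.ofReal (Real.exp (μ / (4 * α * B ^ 2) *
        ‖deviation g α x₀ (fun j => Ξ j ω) t (j + 1)‖ ^ 2)) ∂P ≤ 2 := by
  have hα := hL.step_pos
  have hμ := hL.mu_pos
  have hφc := hL.continuous_gradStep
  set φ := gradStep g α with hφ
  -- Chosen so that `θ α² B² = α μ / 4`: the growth factor from Hoeffding is then `1 + α μ / 2`,
  -- which the contraction `1 - α μ` absorbs.
  set θ := μ / (4 * α * B ^ 2) with hθ
  have hθ0 : 0 ≤ θ := by positivity
  set X : ℕ → Ω → V := fun k ω => noisyPath φ α x₀ (fun j => Ξ j ω) k with hX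
  have hXm : ∀ k, Measurable[F k] (X k) := hN.measurable_path hφc α x₀
  set e : ℕ → Ω → V := fun i ω => deviation g α x₀ (fun j => Ξ j ω) t i with he
  have hYm : ∀ i, Measurable[F (t + i)] fun ω => φ^[i] (X t ω) := fun i =>
    (hφc.iterate i).measurable.comp ((hXm t).mono (hN.mono (Nat.le_add_right t i)) le_rfl)
  have hem : ∀ i, Measurable[F (t + i)] (e i) := fun i => (hXm (t + i)).sub (hYm i)
  set D : ℕ → Set Ω := fun j => {ω | ‖g (X t ω)‖ < ε ∧ ∀ i ≤ j, ‖e i ω‖ ≤ ρ} with hD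
  have hDm : ∀ j, MeasurableSet[F (t + j)] (D j) := fun j => by
    have : D j = X t ⁻¹' {x | ‖g x‖ < ε} ∩ ⋂ i ∈ Set.Iic j, e i ⁻¹' {x | ‖x‖ ≤ ρ} := by
      ext ω; simp [hD]
    rw [this]
    refine MeasurableSet.inter ?_ (MeasurableSet.biInter (Set.to_countable _) fun i hi => ?_)
    · exact (hXm t).mono (hN.mono (Nat.le_add_right t j)) le_rfl
        (isOpen_lt hL.continuous_grad.norm continuous_const).measurableSet
    · exact (hem i).mono (hN.mono (Nat.add_le_add_left hi t)) le_rfl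
        (isClosed_le continuous_norm continuous_const).measurableSet
  set E : V → ℝ := fun v => Real.exp (θ * ‖v‖ ^ 2) with hE
  have hEc : Continuous E := by fun_prop
  have hq1 : α * μ / 2 ≤ 1 := by have := hL.step_mul_mu; nlinarith
  have hq0 : 0 ≤ α * μ / 2 := by positivity
  have hθB : θ * α ^ 2 * B ^ 2 = α * μ / 4 := by rw [hθ]; field_simp
  have hstep : ∀ j, ∫⁻ ω in D j, ENNReal.ofReal (E (e j ω)) ∂P ≤ 2 →
      ∫⁻ ω in D j, ENNReal.ofReal (E (e (j + 1) ω)) ∂P ≤ 2 := fun j ih => by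
    -- The recursion `a ↦ (1 - α μ / 2) a + α μ` has fixed point `2`, whence the bound uniform in
    -- `j`.
    have h1 : ∫⁻ ω in D j, ENNReal.ofReal (E (e (j + 1) ω)) ∂P ≤
        ∫⁻ ω in D j, (ENNReal.ofReal (1 - α * μ / 2) * ENNReal.ofReal (E (e j ω))
          + ENNReal.ofReal (α * μ)) ∂P := by
      refine lintegral_le_of_indep (hN.le (t + j)) ((hXm (t + j)).prodMk (hYm j))
        (hN.measurable (t + j)) (hN.indep (t + j)) (hDm j)
        (h := fun p w => ENNReal.ofReal (E (φ p.1 - φ p.2 - α • w))) ?_ ?_ |>.trans' ?_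
      · exact (hEc.comp (((hφc.comp (continuous_fst.comp continuous_fst)).sub
          (hφc.comp (continuous_snd.comp continuous_fst))).sub
          (continuous_snd.const_smul α))).measurable.ennreal_ofReal
      · refine Eventually.of_forall fun ω hω => ?_
        refine (hN.lintegral_exp_le hB.le (t + j) _ hθ0 α).trans ?_
        rw [← ENNReal.ofReal_mul (by linarith), ← ENNReal.ofReal_add
          (mul_nonneg (by linarith) (Real.exp_pos _).le) (by positivity)]
        refine ENNReal.ofReal_le_ofReal ?_
        have h2 : ‖φ (X (t + j) ω) - φ (φ^[j] (X t ω))‖ ≤ (1 - α * μ) * ‖e j ω‖ :=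
          hL.contract (hL.norm_grad_iterate_lt hρ hω.1 j) (hω.2 j le_rfl)
        have h3 : θ * ‖φ (X (t + j) ω) - φ (φ^[j] (X t ω))‖ ^ 2 *
            (1 + 2 * θ * α ^ 2 * B ^ 2) + θ * α ^ 2 * B ^ 2
            ≤ (1 - α * μ / 2) * (θ * ‖e j ω‖ ^ 2) + α * μ / 2 * (1 / 2) := by
          have h4 : 2 * θ * α ^ 2 * B ^ 2 = α * μ / 2 := by linarith
          have h5 : ‖φ (X (t + j) ω) - φ (φ^[j] (X t ω))‖ ^ 2
              ≤ (1 - α * μ) * ‖e j ω‖ ^ 2 := by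
            calc _ ≤ ((1 - α * μ) * ‖e j ω‖) ^ 2 := pow_le_pow_left₀ (norm_nonneg _) h2 2
              _ = (1 - α * μ) * ((1 - α * μ) * ‖e j ω‖ ^ 2) := by ring
              _ ≤ 1 * ((1 - α * μ) * ‖e j ω‖ ^ 2) := by
                refine mul_le_mul_of_nonneg_right (by linarith [mul_pos hα hμ]) ?_
                exact mul_nonneg hL.one_sub_nonneg (sq_nonneg _)
              _ = _ := one_mul _
          rw [h4, hθB]
          have h6 : (1 - α * μ) * (1 + α * μ / 2) ≤ 1 - α * μ / 2 := by
            nlinarith [mul_pos hα hμ]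
          calc _ ≤ θ * ((1 - α * μ) * ‖e j ω‖ ^ 2) * (1 + α * μ / 2) + α * μ / 4 := by gcongr
            _ = ((1 - α * μ) * (1 + α * μ / 2)) * (θ * ‖e j ω‖ ^ 2) + α * μ / 4 := by ring
            _ ≤ (1 - α * μ / 2) * (θ * ‖e j ω‖ ^ 2) + α * μ / 4 := by
              gcongr
            _ = _ := by ring
        refine (Real.exp_le_exp.2 h3).trans ?_
        -- Convexity of `exp` turns the averaged exponent into an affine recursion for the moment.
        have h7 := convexOn_exp.2 (Set.mem_univ (θ * ‖e j ω‖ ^ 2)) (Set.mem_univ (1 / 2 : ℝ))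
          (by linarith : 0 ≤ 1 - α * μ / 2) hq0 (by ring)
        simp only [smul_eq_mul] at h7
        have h8 : Real.exp (1 / 2) ≤ 2 := by
          have h9 : Real.exp (1 / 2 : ℝ) * Real.exp (1 / 2) = Real.exp 1 := by
            rw [← Real.exp_add]; norm_num
          nlinarith [Real.exp_one_lt_d9, Real.exp_pos (1 / 2)]
        refine h7.trans ?_
        have h10 := mul_le_mul_of_nonneg_left h8 hq0
        linarith
      · refine lintegral_mono fun ω => le_of_eq ?_
        congr 2
        change φ (X (t + j) ω) - α • Ξ (t + j) ω - φ^[j + 1] (X t ω) = _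
        rw [Function.iterate_succ_apply']
        abel
    refine h1.trans ?_
    rw [lintegral_add_right _ measurable_const,
      lintegral_const_mul' _ _ ENNReal.ofReal_ne_top, lintegral_const]
    have h2 : ENNReal.ofReal (α * μ) * P.restrict (D j) Set.univ ≤ ENNReal.ofReal (α * μ) :=
      mul_le_of_le_one_right' (by
        rw [Measure.restrict_apply_univ]; exact prob_le_one)
    refine (add_le_add (mul_le_mul_right ih _) h2).trans (le_of_eq ?_)
    rw [show (2 : ℝ≥0∞) = ENNReal.ofReal 2 by simp, ← ENNReal.ofReal_mul (by linarith),
      ← ENNReal.ofReal_add (by linarith) (by positivity)]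
    congr 1
    ring
  have hind : ∀ j, ∫⁻ ω in D j, ENNReal.ofReal (E (e j ω)) ∂P ≤ 2 := fun j => by
    induction j with
    | zero =>
      have h0 : ∀ ω, e 0 ω = 0 := fun ω => sub_self _
      simp only [h0, hE, norm_zero, ne_eq, OfNat.ofNat_ne_zero, not_false_eq_true, zero_pow,
        mul_zero, Real.exp_zero, ENNReal.ofReal_one, setLIntegral_one]
      exact prob_le_one.trans one_le_two
    | succ j ih =>
      refine (lintegral_mono_set fun ω hω => ?_).trans (hstep j ih)
      exact ⟨hω.1, fun i hi => hω.2 i (hi.trans j.le_succ)⟩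
  exact hstep j (hind j)

theorem NoiseSeq.measure_deviation_le (hN : NoiseSeq P F Ξ S B) (hB : 0 < B)
    (hL : Landscape Q g H α ε μ ρ) (hρ : α * ε ≤ ρ) (x₀ : V) (t j : ℕ) {Δ : ℝ} (hΔ : 0 ≤ Δ) :
    P {ω | (‖g (noisyPath (gradStep g α) α x₀ (fun j => Ξ j ω) t)‖ < ε ∧
        ∀ i ≤ j, ‖deviation g α x₀ (fun j => Ξ j ω) t i‖ ≤ ρ) ∧
        Δ < ‖deviation g α x₀ (fun j => Ξ j ω) t (j + 1)‖}
      ≤ ENNReal.ofReal (2 * Real.exp (-(μ / (4 * α * B ^ 2) * Δ ^ 2))) := by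
  have hα := hL.step_pos
  have hμ := hL.mu_pos
  have hφc := hL.continuous_gradStep
  set θ := μ / (4 * α * B ^ 2) with hθ
  have hθ0 : 0 ≤ θ := by positivity
  set D : Set Ω := {ω | ‖g (noisyPath (gradStep g α) α x₀ (fun j => Ξ j ω) t)‖ < ε ∧
        ∀ i ≤ j, ‖deviation g α x₀ (fun j => Ξ j ω) t i‖ ≤ ρ} with hD
  have hXm : ∀ k, Measurable fun ω => noisyPath (gradStep g α) α x₀ (fun j => Ξ j ω) k :=
    fun k => (hN.measurable_path hφc α x₀ k).mono (hN.le k) le_rfl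
  have hem : ∀ i, Measurable fun ω => deviation g α x₀ (fun j => Ξ j ω) t i := fun i =>
    (hXm (t + i)).sub ((hφc.iterate i).measurable.comp (hXm t))
  set f : Ω → ℝ≥0∞ := fun ω => ENNReal.ofReal (Real.exp (θ *
    ‖deviation g α x₀ (fun j => Ξ j ω) t (j + 1)‖ ^ 2)) with hf
  have hfm : Measurable f := by
    refine (Real.measurable_exp.comp ?_).ennreal_ofReal
    exact ((hem (j + 1)).norm.pow_const 2).const_mul θ
  have h1 := mul_meas_ge_le_lintegral (μ := P.restrict D) hfm
    (ENNReal.ofReal (Real.exp (θ * Δ ^ 2)))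
  have h2 := h1.trans (hN.lintegral_exp_deviation_le hB hL hρ x₀ t j)
  have hms : MeasurableSet {ω | ENNReal.ofReal (Real.exp (θ * Δ ^ 2)) ≤ f ω} :=
    measurableSet_le measurable_const hfm
  rw [Measure.restrict_apply hms] at h2
  have h3 : {ω | ω ∈ D ∧ Δ < ‖deviation g α x₀ (fun j => Ξ j ω) t (j + 1)‖}
      ⊆ {ω | ENNReal.ofReal (Real.exp (θ * Δ ^ 2)) ≤ f ω} ∩ D := fun ω hω =>
    ⟨ENNReal.ofReal_le_ofReal (Real.exp_le_exp.2 (mul_le_mul_of_nonneg_left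
      (pow_le_pow_left₀ hΔ hω.2.le 2) hθ0)), hω.1⟩
  have h4 : ENNReal.ofReal (2 * Real.exp (-(θ * Δ ^ 2)))
      = ENNReal.ofReal (Real.exp (-(θ * Δ ^ 2))) * 2 := by
    rw [mul_comm, ENNReal.ofReal_mul (Real.exp_pos _).le]
    simp
  have h5 : (1 : ℝ≥0∞) = ENNReal.ofReal (Real.exp (-(θ * Δ ^ 2))) *
      ENNReal.ofReal (Real.exp (θ * Δ ^ 2)) := by
    rw [← ENNReal.ofReal_mul (Real.exp_pos _).le, ← Real.exp_add]
    simp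
  calc P _ ≤ P ({ω | ENNReal.ofReal (Real.exp (θ * Δ ^ 2)) ≤ f ω} ∩ D) := measure_mono h3
    _ = ENNReal.ofReal (Real.exp (-(θ * Δ ^ 2))) * (ENNReal.ofReal (Real.exp (θ * Δ ^ 2)) *
        P ({ω | ENNReal.ofReal (Real.exp (θ * Δ ^ 2)) ≤ f ω} ∩ D)) := by
      rw [← mul_assoc, ← h5, one_mul]
    _ ≤ _ := by
      rw [h4]
      exact mul_le_mul_right h2 _

/-- With high probability the noisy descent reaches `‖g‖ < ε` before the time `k₁`, and follows
the noiseless one for `k` further steps. -/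
theorem NoiseSeq.measure_compl_follow_le (hN : NoiseSeq P F Ξ S B) (hB : 0 < B)
    (hL : Landscape Q g H α ε μ ρ) (hρ : α * ε ≤ ρ) (x₀ : V) {Δ : ℝ} (hΔ : 0 ≤ Δ)
    (hΔρ : Δ ≤ ρ) (k₁ k : ℕ) :
    P {ω | ∃ t < k₁, ‖g (noisyPath (gradStep g α) α x₀ (fun j => Ξ j ω) t)‖ < ε ∧
        ∀ j ≤ k, ‖deviation g α x₀ (fun j => Ξ j ω) t j‖ ≤ Δ}ᶜ
      ≤ P {ω | ∀ t < k₁, ε ≤ ‖g (noisyPath (gradStep g α) α x₀ (fun j => Ξ j ω) t)‖} +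
        ENNReal.ofReal (k₁ * k * (2 * Real.exp (-(μ / (4 * α * B ^ 2) * Δ ^ 2)))) := by
  set c := 2 * Real.exp (-(μ / (4 * α * B ^ 2) * Δ ^ 2)) with hc
  set A : ℕ → ℕ → Set Ω := fun t j =>
    {ω | (‖g (noisyPath (gradStep g α) α x₀ (fun j => Ξ j ω) t)‖ < ε ∧
        ∀ i ≤ j, ‖deviation g α x₀ (fun j => Ξ j ω) t i‖ ≤ ρ) ∧
        Δ < ‖deviation g α x₀ (fun j => Ξ j ω) t (j + 1)‖} with hA
  -- If some `t` hits but following fails, consider the first exit `j + 1`: earlier deviations are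
  -- at most `Δ ≤ ρ`. The union over deterministic `t` avoids stopping times.
  have h1 : {ω | ∃ t < k₁, ‖g (noisyPath (gradStep g α) α x₀ (fun j => Ξ j ω) t)‖ < ε ∧
        ∀ j ≤ k, ‖deviation g α x₀ (fun j => Ξ j ω) t j‖ ≤ Δ}ᶜ
      ⊆ {ω | ∀ t < k₁, ε ≤ ‖g (noisyPath (gradStep g α) α x₀ (fun j => Ξ j ω) t)‖} ∪
        ⋃ p ∈ Finset.range k₁ ×ˢ Finset.range k, A p.1 p.2 := by
    intro ω hω
    by_contra hcon
    rw [Set.mem_union, not_or] at hcon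
    obtain ⟨hc1, hc2⟩ := hcon
    have hc1' : ∃ t < k₁, ‖g (noisyPath (gradStep g α) α x₀ (fun j => Ξ j ω) t)‖ < ε := by
      by_contra! h
      exact hc1 h
    obtain ⟨t, ht, hgt⟩ := hc1'
    refine hω ⟨t, ht, hgt, fun j => ?_⟩
    induction j using Nat.strong_induction_on with
    | _ j ih =>
      intro hj
      rcases j with _ | j
      · have : deviation g α x₀ (fun j => Ξ j ω) t 0 = 0 := sub_self _
        rw [this, norm_zero]
        exact hΔ
      · by_contra! hlt
        have hmem : (t, j) ∈ Finset.range k₁ ×ˢ Finset.range k :=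
          Finset.mem_product.2 ⟨Finset.mem_range.2 ht, Finset.mem_range.2 hj⟩
        refine hc2 (Set.mem_iUnion₂.2 ⟨(t, j), hmem, ?_⟩)
        exact ⟨⟨hgt, fun i hi => (ih i (by omega) (by omega)).trans hΔρ⟩, hlt⟩
  refine (measure_mono h1).trans ((measure_union_le _ _).trans (add_le_add (le_refl _) ?_))
  refine (measure_biUnion_finset_le _ _).trans ?_
  refine (Finset.sum_le_sum fun p _ => hN.measure_deviation_le hB hL hρ x₀ p.1 p.2 hΔ).trans ?_
  rw [Finset.sum_const, Finset.card_product, Finset.card_range, Finset.card_range, nsmul_eq_mul,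
    ← ENNReal.ofReal_natCast, ← ENNReal.ofReal_mul (Nat.cast_nonneg _), Nat.cast_mul]

end Coupling

end Noise

/-! ### NDGD as noisy gradient descent on `Q_α`. -/

section Bridge

variable {m n : ℕ} {f : Fin m → Vec n → ℝ} {W : Matrix (Fin m) (Fin m) ℝ} {α : ℝ}

/-- The stacked noise vector. -/
def stackNoise {Ω : Type*} (ξ : ℕ → Fin m → Ω → Vec n) (k : ℕ) (ω : Ω) : Stack m n :=
  WithLp.toLp 2 fun i => ξ k i ω

lemma gradStep_field (hf : ∀ i, ContDiff ℝ 2 (f i)) (hα : α ≠ 0) (x : Stack m n) (i : Fin m) :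
    gradStep (field f W α) α x i = ∑ j, W i j • x j - α • gradient (f i) (x i) := by
  have h1 : gradStep (field f W α) α x i
      = x i - α • (gradient (f i) (x i) + α⁻¹ • (x i - ∑ j, W i j • x j)) := by
    simp only [gradStep, field, gradient_stacked hf, PiLp.sub_apply, PiLp.add_apply,
      PiLp.smul_apply, mix_apply]
  rw [h1, smul_add, smul_inv_smul₀ hα]
  abel

lemma iterate_eq_noisyPath (hf : ∀ i, ContDiff ℝ 2 (f i)) (hα : α ≠ 0) (x₀ : Stack m n)
    (ξ : ℕ → Fin m → Vec n) (k : ℕ) :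
    iterate f W α x₀ ξ k = noisyPath (gradStep (field f W α) α) α x₀
      (fun k => WithLp.toLp 2 fun i => ξ k i) k := by
  induction k with
  | zero => rfl
  | succ k ih =>
    refine PiLp.ext fun i => ?_
    simp only [iterate, noisyPath, ← ih, PiLp.sub_apply, PiLp.smul_apply, gradStep_field hf hα,
      smul_add]
    abel

variable {Ω : Type*} [mΩ : MeasurableSpace Ω] {P : Measure Ω} [IsProbabilityMeasure P]
  {ν : Measure (Vec n)} {σ : ℝ} {ξ : ℕ → Fin m → Ω → Vec n}

/-- The information carried by the noise before time `k`. -/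
abbrev past (ξ : ℕ → Fin m → Ω → Vec n) (k : ℕ) : MeasurableSpace Ω :=
  ⨆ p ∈ {p : ℕ × Fin m | p.1 < k}, MeasurableSpace.comap (ξ p.1 p.2) inferInstance

omit [IsProbabilityMeasure P] in
lemma IsNoise.integral_comp (h : IsNoise P ν ξ) (k : ℕ) (i : Fin m) {g : Vec n → ℝ}
    (hg : Continuous g) : ∫ ω, g (ξ k i ω) ∂P = ∫ v, g v ∂ν := by
  rw [← h.law k i, integral_map (h.meas k i).aemeasurable hg.aestronglyMeasurable]

omit [IsProbabilityMeasure P] in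
lemma IsNoise.integrable_comp (h : IsNoise P ν ξ) (k : ℕ) (i : Fin m) {g : Vec n → ℝ}
    (hg : Integrable g ν) : Integrable (fun ω => g (ξ k i ω)) P := by
  rw [← h.law k i] at hg
  exact hg.comp_measurable (h.meas k i)

lemma NoiseLaw.integrable_id (hν : NoiseLaw ν σ) : Integrable (fun v : Vec n => v) ν := by
  have := hν.prob
  exact hν.memLp.integrable (by norm_num)

lemma NoiseLaw.integrable_norm_sq (hν : NoiseLaw ν σ) :
    Integrable (fun v : Vec n => ‖v‖ ^ 2) ν := hν.memLp.integrable_norm_pow (by norm_num)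

lemma NoiseLaw.integral_norm_sq (hν : NoiseLaw ν σ) :
    ∫ v, ‖v‖ ^ 2 ∂ν = n * σ ^ 2 := by
  have h1 : ∀ a : Fin n, Integrable (fun v : Vec n => v a ^ 2) ν := fun a => by
    refine hν.integrable_norm_sq.mono'
      ((PiLp.continuous_apply 2 _ a).pow 2).aestronglyMeasurable
      (Eventually.of_forall fun v => ?_)
    rw [Real.norm_of_nonneg (sq_nonneg _), ← sq_abs]
    exact pow_le_pow_left₀ (abs_nonneg _) (PiLp.norm_apply_le v a) 2
  have h2 : ∀ v : Vec n, ‖v‖ ^ 2 = ∑ a, v a ^ 2 := fun v => by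
    simp [EuclideanSpace.norm_sq_eq]
  simp only [h2]
  rw [integral_finsetSum _ fun a _ => h1 a]
  have h3 : ∀ a : Fin n, ∫ v, v a ^ 2 ∂ν = σ ^ 2 := fun a => by
    simpa [pow_two] using hν.cov a a
  simp [h3]

lemma measurable_stack {Ω' : Type*} {_ : MeasurableSpace Ω'} {x : Fin m → Ω' → Vec n}
    (h : ∀ i, Measurable (x i)) :
    Measurable fun ω => (WithLp.toLp 2 fun i => x i ω : Stack m n) :=
  (WithLp.measurable_toLp 2 _).comp (measurable_pi_lambda _ h)

omit [IsProbabilityMeasure P] in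
theorem IsNoise.noiseSeq (h : IsNoise P ν ξ) (hν : NoiseLaw ν σ) {B : ℝ}
    (hB : ∀ᵐ v ∂ν, ‖v‖ ≤ B) :
    NoiseSeq P (past ξ) (stackNoise ξ) (m * n * σ ^ 2) (√(m * B ^ 2)) where
  le k := iSup₂_le fun p _ => (h.meas p.1 p.2).comap_le
  mono k l hkl := biSup_mono fun p (hp : p.1 < k) => lt_of_lt_of_le hp hkl
  meas k := measurable_stack fun i =>
    measurable_iff_comap_le.2 (le_iSup₂_of_le (k, i) (Nat.lt_succ_self k) le_rfl)
  indep k := by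
    have h1 : iIndep (fun p : ℕ × Fin m => MeasurableSpace.comap (ξ p.1 p.2) inferInstance) P :=
      h.indep.iIndep
    -- Past and present noise use disjoint sets of indices `(k, i)`.
    have h2 := indep_iSup_of_disjoint (fun p : ℕ × Fin m => (h.meas p.1 p.2).comap_le) h1
      (S := {p : ℕ × Fin m | p.1 < k}) (T := {p : ℕ × Fin m | p.1 = k})
      (Set.disjoint_left.2 fun p hp hp' => (ne_of_lt hp) hp')
    refine indep_of_indep_of_le_right h2 (Measurable.comap_le ?_)
    exact measurable_stack fun i =>
      measurable_iff_comap_le.2 (le_iSup₂_of_le (k, i) rfl le_rfl)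
  mean k u := by
    have h1 : ∀ ω, ⟪u, stackNoise ξ k ω⟫_ℝ = ∑ i, ⟪u i, ξ k i ω⟫_ℝ := fun ω => inner_stack _ _
    simp only [h1]
    rw [integral_finsetSum _ fun i _ => h.integrable_comp k i
      (hν.integrable_id.const_inner (𝕜 := ℝ) (u i))]
    refine Finset.sum_eq_zero fun i _ => ?_
    rw [h.integral_comp k i (g := fun v => ⟪u i, v⟫_ℝ) (continuous_const.inner continuous_id),
      integral_inner hν.integrable_id, hν.mean, inner_zero_right]
  second_moment k := by
    have h1 : ∀ ω, ‖stackNoise ξ k ω‖ ^ 2 = ∑ i, ‖ξ k i ω‖ ^ 2 := fun ω => norm_sq_stack _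
    simp only [h1]
    rw [integral_finsetSum _ fun i _ => h.integrable_comp k i hν.integrable_norm_sq]
    have h2 : ∀ i, ∫ ω, ‖ξ k i ω‖ ^ 2 ∂P = n * σ ^ 2 := fun i => by
      rw [h.integral_comp k i (g := fun v => ‖v‖ ^ 2) (by fun_prop), hν.integral_norm_sq]
    simp [h2, mul_assoc]
  bdd k := by
    have h1 : ∀ i, ∀ᵐ ω ∂P, ‖ξ k i ω‖ ≤ B := fun i => by
      rw [← h.law k i] at hB
      exact ae_of_ae_map (h.meas k i).aemeasurable hB
    filter_upwards [ae_all_iff.2 h1] with ω hω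
    refine Real.le_sqrt_of_sq_le ?_
    rw [norm_sq_stack]
    refine (Finset.sum_le_sum fun i _ => pow_le_pow_left₀ (norm_nonneg _) (hω i) 2).trans ?_
    simp

omit [IsProbabilityMeasure P] in
/-- Bounded iterates force a bounded noise law. -/
lemma IsNoise.exists_bound {Lg LH : Fin m → ℝ≥0} (h : IsNoise P ν ξ)
    (hf : Objectives f Lg LH) (hW : W ∈ doublyStochastic ℝ (Fin m)) (hm : 0 < m) (hα : 0 < α)
    (x₀ : Stack m n) {b : ℝ}
    (hb : ∀ᵐ ω ∂P, ∀ k, |aux f W α (iterate f W α x₀ (fun k i => ξ k i ω) k)| ≤ b) :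
    ∃ B, ∀ᵐ v ∂ν, ‖v‖ ≤ B := by
  obtain ⟨R, -, hR⟩ := hf.exists_norm_le b
  set i₀ : Fin m := ⟨0, hm⟩
  refine ⟨(‖gradStep (field f W α) α x₀ i₀‖ + R) / α, ?_⟩
  rw [← h.law 0 i₀]
  refine (ae_map_iff (h.meas 0 i₀).aemeasurable
    (isClosed_le continuous_norm continuous_const).measurableSet).2 ?_
  filter_upwards [hb] with ω hω
  -- The iterate at time `1` is a deterministic point minus `α` times the noise, so its boundedness
  -- already bounds the law.
  have h1 := hR _ ((stacked_le_aux hW hα _).trans (abs_le.1 (hω 1)).2)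
  have h2 := (norm_block_le _ i₀).trans h1
  rw [iterate_eq_noisyPath hf.smooth hα.ne'] at h2
  have h3 : noisyPath (gradStep (field f W α) α) α x₀
      (fun k => WithLp.toLp 2 fun i => ξ k i ω) 1 i₀
      = gradStep (field f W α) α x₀ i₀ - α • ξ 0 i₀ ω := rfl
  rw [h3] at h2
  rw [le_div_iff₀ hα]
  have h4 : ‖α • ξ 0 i₀ ω‖ = ‖ξ 0 i₀ ω‖ * α := by
    rw [norm_smul, Real.norm_of_nonneg hα.le, mul_comm]
  rw [← h4]
  have h5 := norm_sub_le (gradStep (field f W α) α x₀ i₀)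
    (gradStep (field f W α) α x₀ i₀ - α • ξ 0 i₀ ω)
  rw [sub_sub_cancel] at h5
  linarith

end Bridge

/-! ### Distance to the minimizer at a fixed time. -/

section Conclusion

variable {V : Type*} [NormedAddCommGroup V] [InnerProductSpace ℝ V] [MeasurableSpace V]
  [BorelSpace V] [SecondCountableTopology V] {Ω : Type*} [mΩ : MeasurableSpace Ω]
  [CompleteSpace V] {P : Measure Ω} [IsProbabilityMeasure P] {F : ℕ → MeasurableSpace Ω}
  {Ξ : ℕ → Ω → V} {S B : ℝ} {Q : V → ℝ} {g : V → V} {H : V → V →L[ℝ] V} {α ε μ ρ : ℝ}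

theorem NoiseSeq.measure_far_le (hN : NoiseSeq P F Ξ S B) (hB : 0 < B)
    (hL : Landscape Q g H α ε μ ρ) (hρ : α * ε ≤ ρ) (x₀ : V) {Δ : ℝ} (hΔ : 0 ≤ Δ)
    (hΔρ : Δ ≤ ρ) {p : V} (hp : ∀ q, g q = 0 → q = p) (k₁ k₂ : ℕ) {ζ : ℝ} (hζ : 0 ≤ ζ)
    (hhit : P {ω | ∀ t < k₁, ε ≤ ‖g (noisyPath (gradStep g α) α x₀ (fun j => Ξ j ω) t)‖}
      ≤ ENNReal.ofReal (ζ / 2))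
    (hdev : (k₁ : ℝ) * (k₁ + k₂ : ℕ) * (2 * Real.exp (-(μ / (4 * α * B ^ 2) * Δ ^ 2))) ≤ ζ / 2) :
    P {ω | ‖noisyPath (gradStep g α) α x₀ (fun j => Ξ j ω) (k₁ + k₂) - p‖
      ≤ Δ + ε / μ * (1 - α * μ) ^ k₂}ᶜ ≤ ENNReal.ofReal ζ := by
  have h1 := hN.measure_compl_follow_le hB hL hρ x₀ hΔ hΔρ k₁ (k₁ + k₂)
  have h2 := h1.trans (add_le_add hhit (ENNReal.ofReal_le_ofReal hdev))
  rw [← ENNReal.ofReal_add (by linarith) (by linarith), add_halves] at h2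
  refine (measure_mono (Set.compl_subset_compl.2 fun ω hω => ?_)).trans h2
  obtain ⟨t, ht, hgt, hfollow⟩ := hω
  obtain ⟨q, hq, -, hconv⟩ := hL.exists_tendsto_iterate hρ hgt
  rw [hp q hq] at hconv
  -- The hitting time `t < k₁` is random, but at time `k₁ + k₂` the noiseless path has always run
  -- for at least `k₂` steps.
  have h3 := hfollow (k₁ + k₂ - t) (Nat.sub_le _ _)
  have h4 := hconv (k₁ + k₂ - t)
  rw [deviation, show t + (k₁ + k₂ - t) = k₁ + k₂ by omega] at h3
  have h5 : ε / μ * (1 - α * μ) ^ (k₁ + k₂ - t) ≤ ε / μ * (1 - α * μ) ^ k₂ :=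
    mul_le_mul_of_nonneg_left (pow_le_pow_of_le_one hL.one_sub_nonneg hL.one_sub_lt_one.le
      (by omega)) (div_nonneg hL.eps_pos.le hL.mu_pos.le)
  exact (norm_sub_le_norm_sub_add_norm_sub _ _ _).trans (add_le_add h3 (h4.trans h5))

end Conclusion

/-! ### Elementary estimates for the constants. -/

section Constants

lemma mul_exp_neg_le_half {M a ℓ r k ζ : ℝ} (hM : 1 ≤ M) (hζ : 0 < ζ) (hℓ : 1 ≤ ℓ)
    (hℓζ : Real.log ζ⁻¹ ≤ ℓ) (ha : a = 1 + Real.log (2 * M)) (hk : a * ℓ ≤ r * k) :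
    M * Real.exp (-r * k) ≤ ζ / 2 := by
  have hlog : 0 ≤ Real.log (2 * M) := Real.log_nonneg (by linarith)
  have h1 : Real.log (2 * M) + Real.log ζ⁻¹ ≤ r * k := by
    rw [ha] at hk
    nlinarith
  have h2 : Real.exp (-r * k) ≤ Real.exp (-(Real.log (2 * M) + Real.log ζ⁻¹)) :=
    Real.exp_le_exp.2 (by linarith)
  rw [Real.exp_neg, Real.exp_add, Real.exp_log (by linarith), Real.exp_log (inv_pos.2 hζ)] at h2
  calc M * Real.exp (-r * k) ≤ M * (2 * M * ζ⁻¹)⁻¹ :=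
        mul_le_mul_of_nonneg_left h2 (by linarith)
    _ = ζ / 2 := by field_simp

/-- With `y = α⁻¹ ζ⁻¹ ≤ exp Λ`, the union bound needs `4 k² ζ⁻¹ ≤ 4 c² y⁴`; the factor `4 + log (1 +
4 c²)` in the exponent pays for the power and the constant. -/
lemma sq_mul_exp_neg_le {c k α ζ Λ : ℝ} (hα : 0 < α) (hζ : 0 < ζ) (hζ1 : ζ < 1)
    (hΛ : 1 ≤ Λ) (hΛ' : Real.log (α⁻¹ * ζ⁻¹) ≤ Λ) (hk0 : 0 ≤ k)
    (hk : k ≤ c * (α⁻¹ ^ 2 * max 1 (Real.log ζ⁻¹))) :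
    k ^ 2 * (2 * Real.exp (-((4 + Real.log (1 + 4 * c ^ 2)) * Λ))) ≤ ζ / 2 := by
  have hζi : 1 < ζ⁻¹ := (one_lt_inv₀ hζ).2 hζ1
  have hαi : 0 < α⁻¹ := inv_pos.2 hα
  set y := α⁻¹ * ζ⁻¹ with hy
  have hy0 : 0 < y := by positivity
  have h1 : y ≤ Real.exp Λ := (Real.log_le_iff_le_exp hy0).1 hΛ'
  have hℓ : max 1 (Real.log ζ⁻¹) ≤ ζ⁻¹ :=
    max_le hζi.le ((Real.log_le_sub_one_of_pos (inv_pos.2 hζ)).trans (by linarith))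
  have hℓ1 : 1 ≤ max 1 (Real.log ζ⁻¹) := le_max_left _ _
  have h2 : k ^ 2 * ζ⁻¹ ≤ c ^ 2 * y ^ 4 := by
    have h3 : k ^ 2 ≤ c ^ 2 * (α⁻¹ ^ 2 * ζ⁻¹) ^ 2 := by
      calc k ^ 2 ≤ (c * (α⁻¹ ^ 2 * max 1 (Real.log ζ⁻¹))) ^ 2 := pow_le_pow_left₀ hk0 hk 2
        _ = c ^ 2 * (α⁻¹ ^ 2 * max 1 (Real.log ζ⁻¹)) ^ 2 := by ring
        _ ≤ _ := by gcongr
    calc k ^ 2 * ζ⁻¹ ≤ c ^ 2 * (α⁻¹ ^ 2 * ζ⁻¹) ^ 2 * ζ⁻¹ :=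
          mul_le_mul_of_nonneg_right h3 (by linarith)
      _ = c ^ 2 * (α⁻¹ ^ 4 * ζ⁻¹ ^ 3) * 1 := by ring
      _ ≤ c ^ 2 * (α⁻¹ ^ 4 * ζ⁻¹ ^ 3) * ζ⁻¹ := by gcongr
      _ = c ^ 2 * y ^ 4 := by rw [hy]; ring
  have h4 : Real.exp (4 * Λ) * (1 + 4 * c ^ 2) ≤ Real.exp ((4 + Real.log (1 + 4 * c ^ 2)) * Λ) := by
    have hc : 0 < 1 + 4 * c ^ 2 := by positivity
    have hlog : 0 ≤ Real.log (1 + 4 * c ^ 2) := Real.log_nonneg (by nlinarith [sq_nonneg c])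
    rw [add_mul, Real.exp_add]
    refine mul_le_mul_of_nonneg_left ?_ (Real.exp_pos _).le
    calc 1 + 4 * c ^ 2 = Real.exp (Real.log (1 + 4 * c ^ 2)) := (Real.exp_log hc).symm
      _ ≤ _ := Real.exp_le_exp.2 (by nlinarith)
  have h5 : y ^ 4 ≤ Real.exp (4 * Λ) := by
    calc y ^ 4 ≤ Real.exp Λ ^ 4 := pow_le_pow_left₀ hy0.le h1 4
      _ = Real.exp (4 * Λ) := by rw [← Real.exp_nat_mul]; norm_num
  have h6 : k ^ 2 * ζ⁻¹ * 4 ≤ Real.exp ((4 + Real.log (1 + 4 * c ^ 2)) * Λ) := by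
    have := mul_le_mul_of_nonneg_left h5 (sq_nonneg c)
    nlinarith [Real.exp_pos (4 * Λ)]
  set E := Real.exp ((4 + Real.log (1 + 4 * c ^ 2)) * Λ) with hE
  have hE0 : 0 < E := Real.exp_pos _
  rw [Real.exp_neg]
  have h7 : k ^ 2 * 4 ≤ E * ζ := by
    have := mul_le_mul_of_nonneg_right h6 hζ.le
    calc k ^ 2 * 4 = k ^ 2 * ζ⁻¹ * 4 * ζ := by field_simp
      _ ≤ _ := this
  calc k ^ 2 * (2 * E⁻¹) = k ^ 2 * 4 * E⁻¹ / 2 := by ring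
    _ ≤ E * ζ * E⁻¹ / 2 := by gcongr
    _ = ζ / 2 := by field_simp

/-- `(1 - t)^k ≤ exp (-t k) ≤ 1 / (t k)` with `t = α μ`: spending `α⁻²` steps gives an error linear
in `α` without logarithms. -/
lemma pow_le_of_inv_sq_le {α μ : ℝ} (hα : 0 < α) (hμ : 0 < μ) (h : α * μ ≤ 1) {k : ℕ}
    (hk : α⁻¹ ^ 2 ≤ k) : (1 - α * μ) ^ k ≤ α / μ := by
  have hk0 : (0 : ℝ) < k := lt_of_lt_of_le (by positivity) hk
  have h1 : (1 - α * μ) ^ k ≤ Real.exp (-(α * μ * k)) := by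
    calc (1 - α * μ) ^ k ≤ Real.exp (-(α * μ)) ^ k :=
          pow_le_pow_left₀ (by linarith) (by linarith [Real.add_one_le_exp (-(α * μ))]) k
      _ = Real.exp (-(α * μ * k)) := by rw [← Real.exp_nat_mul]; ring_nf
  have h2 : μ / α ≤ α * μ * k := by
    calc μ / α = α * μ * α⁻¹ ^ 2 := by field_simp
      _ ≤ _ := mul_le_mul_of_nonneg_left hk (by positivity)
  have h3 : μ / α ≤ Real.exp (α * μ * k) := by
    linarith [Real.add_one_le_exp (α * μ * k)]
  calc (1 - α * μ) ^ k ≤ (Real.exp (α * μ * k))⁻¹ := by rw [← Real.exp_neg]; exact h1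
    _ ≤ (μ / α)⁻¹ := inv_anti₀ (by positivity) h3
    _ = α / μ := inv_div _ _

end Constants

/-! ### Choice of the constants and the probabilistic guarantee. -/

section Guarantee

variable {m n : ℕ} {f : Fin m → Vec n → ℝ} {W : Matrix (Fin m) (Fin m) ℝ}
  {Lg LH : Fin m → ℝ≥0} {α ε γ μ δ σ b B : ℝ} {G : SimpleGraph (Fin m)}

lemma Mixing.lamMinMat_le_one [Nontrivial (Stack m n)] (hW : Mixing G W) : lamMinMat W ≤ 1 := by
  obtain ⟨v, hv⟩ := exists_ne (0 : Stack m n)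
  have h1 := lamMinMat_mul_le hW.symm v
  have h2 := inner_sub_mix_nonneg hW.stochastic v
  rw [inner_sub_right, real_inner_self_eq_norm_sq] at h2
  have h3 : 0 < ‖v‖ ^ 2 := pow_pos (norm_pos_iff.2 hv) 2
  nlinarith

lemma natCeil_add_natCeil_le {c A ℓ : ℝ} (hα : 0 < α) (hA : α ≤ A) (hℓ : 1 ≤ ℓ)
    (hc : 0 ≤ c) : ((⌈c * (α⁻¹ * ℓ)⌉₊ + ⌈α⁻¹ ^ 2⌉₊ : ℕ) : ℝ)
      ≤ (c * A + 1 + 2 * A ^ 2) * (α⁻¹ ^ 2 * ℓ) := by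
  have h1 := (Nat.ceil_lt_add_one (show 0 ≤ c * (α⁻¹ * ℓ) by positivity)).le
  have h2 := (Nat.ceil_lt_add_one (show 0 ≤ α⁻¹ ^ 2 by positivity)).le
  have hαi : 0 < α⁻¹ := inv_pos.2 hα
  have h3 : 1 ≤ A * α⁻¹ := by
    rw [← div_eq_mul_inv, le_div_iff₀ hα]; linarith
  have h4 : α⁻¹ ≤ A * α⁻¹ ^ 2 := by nlinarith
  have h5 : 1 ≤ A ^ 2 * α⁻¹ ^ 2 := by nlinarith
  have h6 : c * (α⁻¹ * ℓ) ≤ c * (A * α⁻¹ ^ 2 * ℓ) := by gcongr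
  have h7 : α⁻¹ ^ 2 ≤ α⁻¹ ^ 2 * ℓ := le_mul_of_one_le_right (by positivity) hℓ
  have h8 : A ^ 2 * α⁻¹ ^ 2 ≤ A ^ 2 * (α⁻¹ ^ 2 * ℓ) := by gcongr
  push_cast
  linarith

/-- Noise of total variance `S ≤ λ ε²` does not destroy the expected decrease of an objective with
smoothness constant `(x + 1 - λ) / α` where its gradient is at least `ε`. -/
lemma expected_decrease {x lam S : ℝ} (hx0 : 0 < x) (hx : x ≤ √2 - 1)
    (hlam : lam ≤ 1) (hS : S ≤ lam * ε ^ 2) :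
    1 / 4 * ε ^ 2 ≤ (1 - (x + 1 - lam) / 2) * ε ^ 2 - (x + 1 - lam) / 2 * S := by
  have hκ : 0 ≤ x + 1 - lam := by linarith
  have hx' : x ≤ 0.42 := by
    have : √2 ≤ 1.42 := by
      rw [Real.sqrt_le_left (by norm_num)]; norm_num
    linarith
  have h1 := mul_le_mul_of_nonneg_left hS (by linarith : 0 ≤ (x + 1 - lam) / 2)
  -- The left side is `(1 + x/2)² - (lam - x/2)²`, and `1.21² < 3/2`. This is where `α L ≤ √2 - 1`
  -- is used.
  have h2 : (x + 1 - lam) * (1 + lam) ≤ 3 / 2 := by nlinarith [sq_nonneg (lam - x / 2)]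
  have h3 := mul_le_mul_of_nonneg_right h2 (sq_nonneg ε)
  nlinarith

lemma guarantee_of_near {Δ₁ Δ₂ a : ℝ} (hΔ₁ : 0 ≤ Δ₁) (ha : IsThreshold f W (maxLip Lg) Δ₁ a)
    (hα0 : 0 < α) (hαa : α ≤ a) (hc : Covering f W (maxLip Lg) α ε γ μ δ) {p x : Stack m n}
    (hp : localMinimizers (aux f W α) = {p}) (hx : ‖x - p‖ ≤ Δ₂) :
    Close Δ₂ x (localMinimizers (aux f W α)) ∧
    (∃ y, IsNearest x (localMinimizers (aux f W α)) y) ∧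
    (∀ y, IsNearest x (localMinimizers (aux f W α)) y →
      ∀ i, Close Δ₁ (y i) (localMinimizers (total f))) ∧
    ∀ i, Close (Δ₁ + Δ₂) (x i) (localMinimizers (total f)) := by
  have hΔ₂ : 0 ≤ Δ₂ := (norm_nonneg _).trans hx
  have hpm : p ∈ localMinimizers (aux f W α) := hp ▸ Set.mem_singleton p
  have hthr := ha.2 α ⟨hα0, hαa⟩ ⟨ε, γ, μ, δ, hc⟩
  refine ⟨close_of_norm_sub_le hpm hx, ⟨p, hpm, fun z hz => ?_⟩, fun y hy => hthr y hy.1,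
    fun i => ?_⟩
  · rw [hp, Set.mem_singleton_iff] at hz
    rw [hz]
  · have h1 := hthr p hpm i
    have h2 : edist (x i) (p i) ≤ ENNReal.ofReal Δ₂ := by
      rw [edist_dist, dist_eq_norm]
      exact ENNReal.ofReal_le_ofReal ((norm_block_le (x - p) i).trans hx)
    rw [Close, ENNReal.ofReal_add hΔ₁ hΔ₂]
    exact Metric.infEDist_le_infEDist_add_edist.trans (add_le_add h1 h2)

lemma one_sub_le_of_compl_le {Ω : Type*} [MeasurableSpace Ω] {P : Measure Ω}
    [IsProbabilityMeasure P] {s t : Set Ω} {ζ : ℝ} (hζ : 0 ≤ ζ)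
    (hs : P sᶜ ≤ ENNReal.ofReal ζ) (hst : ∀ᵐ ω ∂P, ω ∈ s → ω ∈ t) : 1 - ζ ≤ P.real t := by
  have h1 : P s ≤ P t := measure_mono_ae hst
  have h2 : (1 : ℝ≥0∞) ≤ P t + ENNReal.ofReal ζ := by
    calc (1 : ℝ≥0∞) = P (s ∪ sᶜ) := by rw [Set.union_compl_self, measure_univ]
      _ ≤ P s + P sᶜ := measure_union_le _ _
      _ ≤ _ := add_le_add h1 hs
  have h3 := ENNReal.toReal_mono (by finiteness) h2
  rw [ENNReal.toReal_add (by finiteness) (by finiteness), ENNReal.toReal_ofReal hζ,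
    ENNReal.toReal_one] at h3
  rw [measureReal_def]
  linarith

universe u

set_option maxHeartbeats 1600000 in
theorem exists_guarantee (hn : 0 < n) (hm : 0 < m) (hW : Mixing G W) (hf : Objectives f Lg LH)
    {a : ℝ} {ν : Measure (Vec n)} (hν : NoiseLaw ν σ) (hσ : σ ^ 2 ≤ lamMinMat W * ε ^ 2 / (m * n))
    (hε : 0 < ε) (hμ : μ ∈ Set.Ioc 0 (maxLip Lg)) (hB : 0 < B) (hνB : ∀ᵐ v ∂ν, ‖v‖ ≤ B) :
    ∃ (cK cΔ : ℝ) (K : ℝ → ℝ → ℕ) (Δ₂ : ℝ → ℝ → ℝ),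
    ∀ ζ ∈ Set.Ioo (0 : ℝ) 1, ∀ α ∈ Set.Ioc 0 (alphaHat W (maxLip Lg) a ζ),
      Covering f W (maxLip Lg) α ε γ μ δ →
      (K α ζ : ℝ) ≤ cK * (α⁻¹ ^ 2 * max 1 (Real.log ζ⁻¹)) ∧
      Δ₂ α ζ ≤ cΔ * √(α * max 1 (Real.log (α⁻¹ * ζ⁻¹))) ∧
      ∀ (Ω : Type u) [MeasurableSpace Ω] (P : Measure Ω) [IsProbabilityMeasure P]
        (ξ : ℕ → Fin m → Ω → Vec n) (x₀ : Stack m n),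
        IsNoise P ν ξ →
        (∀ᵐ ω ∂P, ∀ k, |aux f W α (iterate f W α x₀ (fun k i => ξ k i ω) k)| ≤ b) →
        ∃ p, localMinimizers (aux f W α) = {p} ∧
          1 - ζ ≤ P.real {ω | ‖iterate f W α x₀ (fun k i => ξ k i ω) (K α ζ) - p‖ ≤ Δ₂ α ζ} := by
  have := nontrivial_stack (m := m) hn hm
  have hL : 0 < maxLip Lg := hμ.1.trans_le hμ.2
  set L := maxLip Lg with hLdef
  set lam := lamMinMat W with hlam
  have hlam1 : lam ≤ 1 := hW.lamMinMat_le_one (n := n)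
  set ρ := curvRadius (maxLip LH) μ with hρdef
  have hρ : 0 < ρ := div_pos hμ.1 (by linarith [maxLip_nonneg LH])
  obtain ⟨R, hR0, hR⟩ := hf.exists_norm_le b
  obtain ⟨c, hc⟩ := hf.exists_stacked_lower_bound
  have hm' : (0 : ℝ) < m := Nat.cast_pos.2 hm
  have hn' : (0 : ℝ) < n := Nat.cast_pos.2 hn
  set B' := √(m * B ^ 2) with hB'def
  have hB' : 0 < B' := Real.sqrt_pos.2 (by positivity)
  -- The objective is shifted by `1 - c` so as to lie between `1` and `M` along the path.
  set M := |b| + |c| + 1 with hMdef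
  have hM1 : 1 ≤ M := by linarith [abs_nonneg b, abs_nonneg c]
  set μ' := μ / 2 with hμ'def
  have hμ' : 0 < μ' := half_pos hμ.1
  set a₁ := 1 + Real.log (2 * M) with ha₁
  have ha₁0 : 0 < a₁ := by
    have := Real.log_nonneg (by linarith : 1 ≤ 2 * M)
    linarith
  set c₁ := 4 * M * a₁ / ε ^ 2 with hc₁
  have hc₁0 : 0 ≤ c₁ := by positivity
  set cK := c₁ * (1 / L) + 1 + 2 * (1 / L) ^ 2 with hcK
  set c₃ := 4 + Real.log (1 + 4 * cK ^ 2) with hc₃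
  have hc₃0 : 0 < c₃ := by
    have := Real.log_nonneg (by nlinarith [sq_nonneg cK] : 1 ≤ 1 + 4 * cK ^ 2)
    linarith
  set C := 4 * B' ^ 2 / μ' * c₃ with hC
  have hC0 : 0 < C := by positivity
  set c₀ := min (ρ ^ 2 / C) (ρ / ε) with hc₀
  have hc₀0 : 0 < c₀ := by positivity
  -- The three terms pay for the deviation of the paths, the remaining distance of the noiseless
  -- path, and the regime of large `α Λ`.
  set cΔ := √C + ε / μ' ^ 2 * √(1 / L) + 2 * R / √c₀ with hcΔ
  refine ⟨cK, cΔ, fun α ζ => ⌈c₁ * (α⁻¹ * max 1 (Real.log ζ⁻¹))⌉₊ + ⌈α⁻¹ ^ 2⌉₊,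
    fun α ζ => cΔ * √(α * max 1 (Real.log (α⁻¹ * ζ⁻¹))), ?_⟩
  rintro ζ ⟨hζ0, hζ1⟩ α ⟨hα0, hαhat⟩ hcov
  set ℓ := max 1 (Real.log ζ⁻¹) with hℓ
  have hℓ1 : 1 ≤ ℓ := le_max_left _ _
  set Λ := max 1 (Real.log (α⁻¹ * ζ⁻¹)) with hΛ
  have hΛ1 : 1 ≤ Λ := le_max_left _ _
  have hαL : α * L ≤ √2 - 1 := by
    have : α ≤ (√2 - 1) / L := hαhat.trans ((min_le_right _ _).trans (min_le_left _ _))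
    rwa [le_div_iff₀ hL] at this
  have hαL0 : 0 < α * L := mul_pos hα0 hL
  have hαlam : α * L ≤ lam := by
    have h1 : α ≤ lam / (L * ℓ) := hαhat.trans ((min_le_right _ _).trans (min_le_right _ _))
    rw [le_div_iff₀ (by positivity)] at h1
    nlinarith
  have hαL1 : α * L ≤ 1 := hαlam.trans hlam1
  have hαA : α ≤ 1 / L := by rwa [le_div_iff₀ hL]
  have hLα : L ≤ α⁻¹ := by rw [← one_div, le_div_iff₀ hα0]; linarith
  have hKle := natCeil_add_natCeil_le hα0 hαA hℓ1 hc₁0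
  refine ⟨hKle, le_rfl, fun Ω _ P _ ξ x₀ hξ hb => ?_⟩
  obtain ⟨p, -, hp, hpmin⟩ := hcov.exists_unique_minimizer hf hW hα0 hLα
  refine ⟨p, hp, ?_⟩
  set k₁ := ⌈c₁ * (α⁻¹ * ℓ)⌉₊ with hk₁
  set k₂ := ⌈α⁻¹ ^ 2⌉₊ with hk₂
  set Ξ := stackNoise ξ with hΞ
  have hN := hξ.noiseSeq hν hνB
  have hit : ∀ ω k, iterate f W α x₀ (fun k i => ξ k i ω) k
      = noisyPath (gradStep (field f W α) α) α x₀ (fun j => Ξ j ω) k := fun ω k =>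
    iterate_eq_noisyPath hf.smooth hα0.ne' x₀ _ k
  -- If `α Λ ≥ c₀` the claim is trivial: iterate and minimizer both lie in the ball of radius `R`.
  -- Otherwise `α` is small enough for `α ε ≤ ρ` and `Δ ≤ ρ`.
  rcases le_or_gt c₀ (α * Λ) with hcase | hcase
  · refine one_sub_le_of_compl_le hζ0.le (s := Set.univ) (by simp) ?_
    filter_upwards [hb] with ω hω _
    have h1 : aux f W α (iterate f W α x₀ (fun k i => ξ k i ω) (k₁ + k₂)) ≤ b :=
      (abs_le.1 (hω _)).2
    have h2 := hR _ ((stacked_le_aux hW.stochastic hα0 _).trans h1)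
    have h3 := hR p ((stacked_le_aux hW.stochastic hα0 _).trans ((hpmin _).trans h1))
    have h4 : √c₀ ≤ √(α * Λ) := Real.sqrt_le_sqrt hcase
    have h5 : 0 < √c₀ := Real.sqrt_pos.2 hc₀0
    have h6 : 2 * R ≤ 2 * R / √c₀ * √(α * Λ) := by
      rw [div_mul_eq_mul_div, le_div_iff₀ h5]
      exact mul_le_mul_of_nonneg_left h4 (by linarith)
    have h7 : 0 ≤ (√C + ε / μ' ^ 2 * √(1 / L)) * √(α * Λ) := by positivity
    calc _ ≤ R + R := (norm_sub_le _ _).trans (add_le_add h2 h3)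
      _ ≤ cΔ * √(α * Λ) := by rw [hcΔ, add_mul]; linarith
  · have hαc : α ≤ α * Λ := le_mul_of_one_le_right hα0.le hΛ1
    have hαε : α * ε ≤ ρ := by
      have : α ≤ ρ / ε := hαc.trans (hcase.le.trans (min_le_right _ _))
      rwa [le_div_iff₀ hε] at this
    have hCρ : C * (α * Λ) ≤ ρ ^ 2 := by
      have : α * Λ ≤ ρ ^ 2 / C := hcase.le.trans (min_le_left _ _)
      rw [le_div_iff₀ hC0] at this
      linarith
    have hαμ : α * μ' ≤ 1 := by
      have h1 : α * μ' ≤ α * L := mul_le_mul_of_nonneg_left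
        (by linarith [hμ.2, half_le_self hμ.1.le]) hα0.le
      linarith
    have hland := hcov.landscape hf hW hα0 hLα hα0
      (by rw [mul_add, ← mul_assoc, mul_inv_cancel₀ hα0.ne']; linarith) hαμ
    set κ := α * L + 1 - lam with hκ
    have hκ0 : 0 < κ := by linarith
    have hκ1 : κ ≤ 1 := by linarith
    -- The longer step `α / κ` encodes the true smoothness constant `κ / α` of `Q_α`, which the
    -- expected decrease under noise requires.
    have hland' := hcov.landscape hf hW hα0 hLα (s := α / κ) (by positivity)
      (by
        rw [div_mul_eq_mul_div, mul_add, ← mul_assoc, mul_inv_cancel₀ hα0.ne',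
          div_le_one hκ0]
        linarith)
      (by
        rw [div_mul_eq_mul_div, div_le_one hκ0, ← hμ'def]
        have h1 : α * μ' ≤ α * L := mul_le_mul_of_nonneg_left
          (by linarith [hμ.2, half_le_self hμ.1.le]) hα0.le
        linarith)
    have hS : (m : ℝ) * n * σ ^ 2 ≤ lam * ε ^ 2 := by
      rw [le_div_iff₀ (by positivity)] at hσ
      linarith
    have hdesc : ∀ x v : Stack m n, aux f W α (x + v) + (1 - c) ≤ aux f W α x + (1 - c) +
        ⟪field f W α x, v⟫_ℝ + κ / (2 * α) * ‖v‖ ^ 2 := fun x v => by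
      have h1 := hland'.descent x v
      have h2 : 1 / (2 * (α / κ)) = κ / (2 * α) := by field_simp
      rw [h2] at h1
      linarith
    have hone : ∀ x : Stack m n, 1 ≤ aux f W α x + (1 - c) := fun x => by
      linarith [hc x, stacked_le_aux (f := f) hW.stochastic hα0 x]
    have hbM : ∀ᵐ ω ∂P, ∀ k, aux f W α (noisyPath (gradStep (field f W α) α) α x₀
        (fun j => Ξ j ω) k) + (1 - c) ≤ M := by
      filter_upwards [hb] with ω hω k
      rw [← hit]
      linarith [(abs_le.1 (hω k)).2, le_abs_self b, neg_abs_le c]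
    have hcont : Continuous fun x : Stack m n => aux f W α x + (1 - c) :=
      (contDiff_aux hf.smooth).continuous.add continuous_const
    have hhit := hN.measure_forall_le_norm_grad hcont hland.continuous_grad hα0 hκ0.le
      (by linarith) hdesc hε.le (by norm_num : (0 : ℝ) ≤ 1 / 4)
      (expected_decrease hαL0 hαL hlam1 hS) hone (by linarith) hbM k₁
    have hhit' := hhit.trans (ENNReal.ofReal_le_ofReal (mul_exp_neg_le_half (a := a₁) (ℓ := ℓ)
      hM1 hζ0 hℓ1 (le_max_right _ _) ha₁ (by
        have h1 : c₁ * (α⁻¹ * ℓ) ≤ k₁ := Nat.le_ceil _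
        have h2 : α * (1 / 4) * ε ^ 2 / M * (c₁ * (α⁻¹ * ℓ)) = a₁ * ℓ := by
          rw [hc₁]; field_simp
        rw [← h2]
        exact mul_le_mul_of_nonneg_left h1 (by positivity))))
    -- `C` is designed so that the exponent in the deviation bound equals `c₃ Λ`.
    set Δ := √(C * (α * Λ)) with hΔ
    have hΔsq : Δ ^ 2 = C * (α * Λ) := Real.sq_sqrt (by positivity)
    have hΔρ : Δ ≤ ρ := Real.sqrt_le_iff.2 ⟨hρ.le, hCρ⟩
    have hθ : μ' / (4 * α * B' ^ 2) * Δ ^ 2 = c₃ * Λ := by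
      rw [hΔsq, hC]; field_simp
    have hdev : (k₁ : ℝ) * (k₁ + k₂ : ℕ) * (2 * Real.exp (-(μ' / (4 * α * B' ^ 2) * Δ ^ 2)))
        ≤ ζ / 2 := by
      rw [hθ]
      refine le_trans (mul_le_mul_of_nonneg_right ?_ (by positivity))
        (sq_mul_exp_neg_le hα0 hζ0 hζ1 hΛ1 (le_max_right _ _) (Nat.cast_nonneg _) hKle)
      rw [pow_two]
      exact mul_le_mul_of_nonneg_right (Nat.cast_le.2 (Nat.le_add_right _ _)) (Nat.cast_nonneg _)
    have huniq : ∀ q, field f W α q = 0 → q = p := fun q hq => by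
      have h1 : q ∈ localMinimizers (aux f W α) := by
        rw [hcov.localMinimizers_aux hf hW hα0 hLα]
        exact hq
      rwa [hp, Set.mem_singleton_iff] at h1
    have hfar := hN.measure_far_le hB' hland hαε x₀ (Real.sqrt_nonneg _) hΔρ huniq k₁ k₂
      hζ0.le hhit' hdev
    refine one_sub_le_of_compl_le hζ0.le hfar (Eventually.of_forall fun ω hω => ?_)
    rw [Set.mem_ofPred_eq, hit]
    refine le_trans (Set.mem_ofPred_eq ▸ hω) ?_
    have h1 := pow_le_of_inv_sq_le hα0 hμ' hαμ (Nat.le_ceil (α⁻¹ ^ 2))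
    have h2 : Δ = √C * √(α * Λ) := Real.sqrt_mul hC0.le _
    have h3 : α ≤ √(1 / L) * √(α * Λ) := by
      rw [← Real.sqrt_mul (by positivity)]
      refine Real.le_sqrt_of_sq_le ?_
      rw [pow_two]
      exact mul_le_mul hαA hαc hα0.le (by positivity)
    have h4 : ε / μ' * (1 - α * μ') ^ k₂ ≤ ε / μ' ^ 2 * √(1 / L) * √(α * Λ) := by
      calc ε / μ' * (1 - α * μ') ^ k₂ ≤ ε / μ' * (α / μ') :=
            mul_le_mul_of_nonneg_left h1 (by positivity)
        _ = ε / μ' ^ 2 * α := by field_simp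
        _ ≤ ε / μ' ^ 2 * (√(1 / L) * √(α * Λ)) := mul_le_mul_of_nonneg_left h3 (by positivity)
        _ = _ := by ring
    have h5 : 0 ≤ 2 * R / √c₀ * √(α * Λ) := by positivity
    change Δ + ε / μ' * (1 - α * μ') ^ k₂ ≤ cΔ * √(α * Λ)
    rw [h2, hcΔ, add_mul, add_mul]
    linarith

end Guarantee

end NDGD

end

theorem theorem2 {m n : ℕ} (hn : 0 < n)
    (G : SimpleGraph (Fin m)) (hG : G.Connected)
    (W : Matrix (Fin m) (Fin m) ℝ) (hW : NDGD.Mixing G W)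
    (f : Fin m → NDGD.Vec n → ℝ) (Lg LH : Fin m → ℝ≥0) (hf : NDGD.Objectives f Lg LH)
    (Δ₁ : ℝ) (hΔ₁ : 0 < Δ₁) :
    -- a threshold exists, and the guarantee holds with every threshold
    (∃ a : ℝ, NDGD.IsThreshold f W (NDGD.maxLip Lg) Δ₁ a) ∧
    ∀ a : ℝ, NDGD.IsThreshold f W (NDGD.maxLip Lg) Δ₁ a →
    ∀ (ε γ μ δ σ b : ℝ) (ν : Measure (NDGD.Vec n)), NDGD.NoiseLaw ν σ →
      σ ^ 2 ≤ NDGD.lamMinMat W * ε ^ 2 / (m * n) →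
    -- the constants and the two functions depend on the data above only
    ∃ (cK cΔ : ℝ) (K : ℝ → ℝ → ℕ) (Δ₂ : ℝ → ℝ → ℝ),
    ∀ ζ ∈ Set.Ioo (0 : ℝ) 1, ∀ α ∈ Set.Ioc 0 (NDGD.alphaHat W (NDGD.maxLip Lg) a ζ),
      NDGD.Covering f W (NDGD.maxLip Lg) α ε γ μ δ →
      (K α ζ : ℝ) ≤ cK * (α⁻¹ ^ 2 * max 1 (Real.log ζ⁻¹)) ∧
      Δ₂ α ζ ≤ cΔ * √(α * max 1 (Real.log (α⁻¹ * ζ⁻¹))) ∧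
      ∀ (Ω : Type*) [MeasurableSpace Ω] (P : Measure Ω) [IsProbabilityMeasure P]
        (ξ : ℕ → Fin m → Ω → NDGD.Vec n) (x₀ : NDGD.Stack m n),
        NDGD.IsNoise P ν ξ →
        (∀ᵐ ω ∂P, ∀ k,
          |NDGD.aux f W α (NDGD.iterate f W α x₀ (fun k i => ξ k i ω) k)| ≤ b) →
        1 - ζ ≤ P.real {ω |
          let x := NDGD.iterate f W α x₀ (fun k i => ξ k i ω) (K α ζ)
          NDGD.Close (Δ₂ α ζ) x (NDGD.localMinimizers (NDGD.aux f W α)) ∧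
          (∃ y, NDGD.IsNearest x (NDGD.localMinimizers (NDGD.aux f W α)) y) ∧
          (∀ y, NDGD.IsNearest x (NDGD.localMinimizers (NDGD.aux f W α)) y →
            ∀ i, NDGD.Close Δ₁ (y i) (NDGD.localMinimizers (NDGD.total f))) ∧
          ∀ i, NDGD.Close (Δ₁ + Δ₂ α ζ) (x i) (NDGD.localMinimizers (NDGD.total f))} := by
  have hm : 0 < m := Fin.pos_iff_nonempty.2 hG.nonempty
  refine ⟨NDGD.exists_isThreshold hn hG hW hf hΔ₁, fun a ha ε γ μ δ σ b ν hν hσ => ?_⟩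
  by_cases hpos : 0 < ε ∧ μ ∈ Set.Ioc 0 (NDGD.maxLip Lg)
  swap
  -- With such parameters no step-size satisfies the covering condition.
  · exact ⟨0, 0, 0, 0, fun ζ _ α _ hc => absurd ⟨hc.eps_pos, hc.mu_mem⟩ hpos⟩
  by_cases hbdd : ∃ B, ∀ᵐ v ∂ν, ‖v‖ ≤ B
  swap
  -- An unbounded noise law contradicts the boundedness of `Q_α` along the iterates, so zero
  -- constants do.
  · refine ⟨0, 0, 0, 0, fun ζ _ α hα _ => ⟨by simp, by simp, fun Ω _ P _ ξ x₀ hξ hb => ?_⟩⟩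
    exact absurd (hξ.exists_bound hf hW.stochastic hm hα.1 x₀ hb) hbdd
  obtain ⟨B, hB⟩ := hbdd
  obtain ⟨cK, cΔ, K, Δ₂, h⟩ := NDGD.exists_guarantee (γ := γ) (δ := δ) (b := b) (a := a) hn hm hW hf
    hν hσ hpos.1 hpos.2 (B := max B 1) (by positivity)
    (hB.mono fun v hv => hv.trans (le_max_left _ _))
  refine ⟨cK, cΔ, K, Δ₂, fun ζ hζ α hα hc => ?_⟩
  obtain ⟨hK, hΔ, hmain⟩ := h ζ hζ α hα hc
  refine ⟨hK, hΔ, fun Ω _ P _ ξ x₀ hξ hb => ?_⟩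
  obtain ⟨p, hp, hle⟩ := hmain Ω P ξ x₀ hξ hb
  refine hle.trans (measureReal_mono fun ω hω => ?_)
  exact NDGD.guarantee_of_near hΔ₁.le ha hα.1 (hα.2.trans (min_le_left _ _)) hc hp hω
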